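/- Let $f:\mathbb{R}^d\to\mathbb{R}^d$ be $C^1$, let $\Phi:\mathbb{R}^d\to\mathbb{R}$ be continuous, and let $B\subset\mathbb{R}^d$ be a nonempty compact set such that every solution of $\dot x=f(x)$ starting in $B$ remains in $B$ for as long as it is defined in forward time. Then each $x_0\in B$ has a unique solution $t\mapsto\varphi_t(x_0)$ on $[0,\infty)$, and it stays in $B$. Write \[ \overline\Phi(x_0)=\limsup_{T\to\infty}\frac1T\int_0^T\Phi(\varphi_t(x_0))\,dt . \] Let $C^1(B)$ be the set of functions that are continuously differentiable on an open neighbourhood of $B$, and let $\mathrm{Pr}(B)$ be the set of Borel probability measures on $B$. A measure $\mu\in\mathrm{Pr}(B)$ is invariant if $\mu(\varphi_t^{-1}A)=\mu(A)$ for all Borel $A\subseteq B$ and all $t\ge0$. It is ergodic if it is invariant and $\mu(A)\in\{0,1\}$ for every Borel $A\subseteq B$ with $\varphi_t^{-1}A=A$ for all $t\ge 0$. Write $\operatorname{div}(f\mu)=0$ if $\int f\cdot\nabla\psi\,d\mu=0$ for all smooth compactly supported $\psi:\mathbb{R}^d\to\mathbb{R}$. Then the following hold. (a) A measure $\mu\in\mathrm{Pr}(B)$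 is invariant if and only if $\operatorname{div}(f\mu)=0$. (b) For $\mu\in\mathrm{Pr}(B)$, $\inf_{V\in C^1(B)}\int f\cdot\nabla V\,d\mu$ equals $0$ if $\operatorname{div}(f\mu)=0$ and $-\infty$ otherwise. (c) For every $V\in C^1(B)$ the function $\Phi+f\cdot\nabla V$ attains its maximum over $B$. (d) The following equalities hold, their common value is a real number, and the first two maxima are attained: \[ \begin{aligned} \max_{x_0\in B}\overline\Phi(x_0) &=\max_{\substack{\mu\in \mathrm{Pr}(B)\\ \mu\text{ invariant}}}\int\Phi\,d\mu =\sup_{\mu\in \mathrm{Pr}(B)}\ \inf_{V\in C^1(B)}\int(\Phi+f\cdot\nabla V)\,d\mu\\ &=\inf_{V\in C^1(B)}\ \sup_{\mu\in \mathrm{Pr}(B)}\int(\Phi+f\cdot\nabla V)\,d\mu =\inf_{V\in C^1(B)}\ \max_{x\in B}\,\bigl(\Phi+f\cdot\nabla V\bigr)(x). \end{aligned} \] Moreover the maximum over invariant measures is attained at an ergodic measure. -/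

import Mathlib

open Set Filter Topology MeasureTheory
open scoped NNReal ContDiff Gradient

/-- Phase space: `ℝ^d` with the Euclidean norm and inner product. -/
abbrev PhaseSpace (d : ℕ) : Type := EuclideanSpace ℝ (Fin d)

/-- Trajectories beginning in `B` remain there: every solution of `x' = f(x)` on a time interval
`[0, T]` (one-sided derivatives at the end points) with `x(0) ∈ B` satisfies `x(t) ∈ B` for all
`t ∈ [0, T]`. -/
def TrapsTrajectories {d : ℕ} (f : PhaseSpace d → PhaseSpace d) (B : Set (PhaseSpace d)) : Prop :=
  ∀ (T : ℝ) (x : ℝ → PhaseSpace d), IsIntegralCurveOn x (fun _ => f) (Icc 0 T) →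
    x 0 ∈ B → ∀ t ∈ Icc 0 T, x t ∈ B

/-- `φ` is the forward flow of `x' = f(x)` on `B`: for each `x₀ ∈ B` the curve `t ↦ φ t x₀`,
`t ≥ 0`, starts at `x₀` and solves the equation on `[0, ∞)` (one-sided derivative at `0`). -/
def IsFlowOn {d : ℕ} (f : PhaseSpace d → PhaseSpace d) (B : Set (PhaseSpace d))
    (φ : ℝ≥0 → B → B) : Prop :=
  ∀ x₀ : B, φ 0 x₀ = x₀ ∧
    IsIntegralCurveOn (fun t : ℝ => (φ t.toNNReal x₀ : PhaseSpace d)) (fun _ => f) (Ici 0)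

/-- The long-time average `limsup_{T → ∞} (1/T) ∫_0^T Φ(x(t)) dt` along a curve `x`. -/
noncomputable def longTimeAverage {d : ℕ} (Φ : PhaseSpace d → ℝ) (x : ℝ≥0 → PhaseSpace d) :
    EReal :=
  limsup (fun T : ℝ => (((1 / T) * ∫ t in (0 : ℝ)..T, Φ (x t.toNNReal) : ℝ) : EReal)) atTop

/-- The auxiliary functions `C^1(B)`: functions that are continuously differentiable on an open
neighbourhood of `B` (their values away from that neighbourhood are irrelevant). -/
def auxFunctions {d : ℕ} (B : Set (PhaseSpace d)) : Set (PhaseSpace d → ℝ) :=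
  {V | ∃ U : Set (PhaseSpace d), IsOpen U ∧ B ⊆ U ∧ ContDiffOn ℝ 1 V U}

/-- The function `f · ∇V`. -/
noncomputable def orbitalDeriv {d : ℕ} (f : PhaseSpace d → PhaseSpace d) (V : PhaseSpace d → ℝ)
    (x : PhaseSpace d) : ℝ :=
  inner ℝ (f x) (∇ V x)

/-- The Lagrangian `L(μ, V) = ∫ (Φ + f · ∇V) dμ`. -/
noncomputable def lagrangian {d : ℕ} (f : PhaseSpace d → PhaseSpace d) (Φ : PhaseSpace d → ℝ)
    {B : Set (PhaseSpace d)} (μ : ProbabilityMeasure B) (V : PhaseSpace d → ℝ) : ℝ :=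
  ∫ x : B, (Φ x + orbitalDeriv f V x) ∂(μ : Measure B)

/-- `μ` is invariant under `φ`: `μ(φ_t⁻¹ A) = μ(A)` for all Borel `A ⊆ B` and all `t ≥ 0`. -/
def IsInvariantMeasure {d : ℕ} {B : Set (PhaseSpace d)} (φ : ℝ≥0 → B → B)
    (μ : ProbabilityMeasure B) : Prop :=
  ∀ (t : ℝ≥0) (A : Set B), MeasurableSet A → (μ : Measure B) (φ t ⁻¹' A) = (μ : Measure B) A

/-- `μ` is invariant, and gives measure zero or one to each invariant Borel set. -/
def IsErgodicMeasure {d : ℕ} {B : Set (PhaseSpace d)} (φ : ℝ≥0 → B → B)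
    (μ : ProbabilityMeasure B) : Prop :=
  IsInvariantMeasure φ μ ∧
    ∀ A : Set B, MeasurableSet A → (∀ t : ℝ≥0, φ t ⁻¹' A = A) →
      (μ : Measure B) A = 0 ∨ (μ : Measure B) A = 1

/-- `div (f μ) = 0` weakly: `∫ f · ∇ψ dμ = 0` for all smooth compactly supported `ψ` on `ℝ^d`. -/
def IsWeaklyDivFree {d : ℕ} (f : PhaseSpace d → PhaseSpace d) {B : Set (PhaseSpace d)}
    (μ : ProbabilityMeasure B) : Prop :=
  ∀ ψ : PhaseSpace d → ℝ, ContDiff ℝ ∞ ψ → HasCompactSupport ψ →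
    ∫ x : B, orbitalDeriv f ψ x ∂(μ : Measure B) = 0

/-! Weak duality comes from `d/dt V(φ_t x) = (f · ∇V)(φ_t x)`. Averaging over time shows that an
upper bound for `Φ + f · ∇V` on `B` bounds every long-time average of `Φ`; integrating against an
invariant `μ` gives `∫ f · ∇V dμ = 0`, so the bound also holds for `∫ Φ dμ`.

Strong duality is Hahn–Banach. The map `h ↦ inf_V max_B (h + f · ∇V)` is sublinear, and finite
because `f · ∇V ≥ 0` where `V` is minimal on `B`. A dominated linear functional that agrees with it
at `Φ` is positive and normalized, hence a probability measure by Riesz, and it annihilates every `f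
· ∇V` (`exists_probabilityMeasure_annihilating`).

Such a measure is divergence-free; that it is invariant is the analytic point. The transported
function `V ∘ φ_t` is Lipschitz, and its derivative along the flow is `(f · ∇V) ∘ φ_t`.
Mollification gives smooth functions whose derivatives along `f` are uniformly close to it, so `∫ (f
· ∇V) ∘ φ_t dμ = 0` and `∫ V ∘ φ_t dμ` does not depend on `t`.

A trajectory reaching the optimum is found without an ergodic theorem: finite-time averages have
`μ`-mean `∫ Φ dμ`, so by the reverse Fatou lemma their limsup is at least this mean at some point.
An ergodic optimal measure is an extreme point of the compact convex set of optimal measures. -/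

/-- A smooth cutoff function: equal to one near a compact set, supported in an open one. -/
theorem exists_contDiff_cutoff {E : Type*} [NormedAddCommGroup E] [NormedSpace ℝ E]
    [FiniteDimensional ℝ E] {B U : Set E} (hB : IsCompact B) (hU : IsOpen U) (hBU : B ⊆ U) :
    ∃ χ : E → ℝ, ContDiff ℝ ∞ χ ∧ HasCompactSupport χ ∧ tsupport χ ⊆ U ∧
      ∀ᶠ x in 𝓝ˢ B, χ x = 1 := by
  obtain ⟨K, hK, hBK, hKU⟩ := exists_compact_between hB hU hBU
  obtain ⟨χ, h1, h0, -⟩ := exists_contMDiffMap_one_nhds_of_subset_interior (n := ⊤)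
    (modelWithCornersSelf ℝ E) hB.isClosed hBK
  have hsupp : tsupport χ ⊆ K := closure_minimal
    (fun x hx => by by_contra h; exact hx (h0 x h)) hK.isClosed
  exact ⟨χ, χ.contMDiff.contDiff, hK.of_isClosed_subset (isClosed_tsupport _) hsupp,
    hsupp.trans hKU, h1⟩

/-! ### Global flows of bounded Lipschitz vector fields -/

section GlobalFlow

variable {E : Type*} [NormedAddCommGroup E] [NormedSpace ℝ E] {g : E → E} {K : ℝ≥0} {C : ℝ≥0}
  {Ψ : ℝ → E → E}

/-- `Ψ` is the global flow of the vector field `g`. -/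
structure IsGlobalFlow (g : E → E) (Ψ : ℝ → E → E) : Prop where
  zero : ∀ x, Ψ 0 x = x
  isIntegralCurve : ∀ x, IsIntegralCurve (fun t => Ψ t x) (fun _ => g)

/-- A bounded Lipschitz vector field has a global integral curve through each point. -/
theorem LipschitzWith.exists_isIntegralCurve [CompleteSpace E] (hg : LipschitzWith K g)
    (hC : ∀ x, ‖g x‖ ≤ C) (x : E) :
    ∃ γ : ℝ → E, γ 0 = x ∧ IsIntegralCurve γ (fun _ => g) := by
  have key : ∀ n : ℕ, ∃ α : ℝ → E, α 0 = x ∧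
      ∀ t ∈ Ioo (-((n : ℝ) + 1)) ((n : ℝ) + 1), HasDerivAt α (g (α t)) t := by
    intro n
    -- Speed at most `C` keeps a curve in the ball of radius `C (n + 1)` for time `n + 1`, so no
    -- smallness of the time interval is needed.
    have hpl : IsPicardLindelof (fun _ => g) (tmin := -((n : ℝ) + 1)) (tmax := (n : ℝ) + 1)
        ⟨0, by constructor <;> linarith [(n.cast_nonneg : (0 : ℝ) ≤ n)]⟩ x (C * (n + 1)) 0 C K :=
      IsPicardLindelof.of_time_independent (fun y _ => hC y) hg.lipschitzOnWith (by simp)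
    obtain ⟨α, h0, hα⟩ := hpl.exists_eq_forall_mem_Icc_hasDerivWithinAt₀
    exact ⟨α, h0, fun t ht => (hα t (Ioo_subset_Icc_self ht)).hasDerivAt (Icc_mem_nhds ht.1 ht.2)⟩
  choose α h0 hα using key
  have huniq : ∀ m n : ℕ, m ≤ n → EqOn (α m) (α n) (Ioo (-((m : ℝ) + 1)) ((m : ℝ) + 1)) := by
    intro m n hmn
    have hmn' : (m : ℝ) ≤ n := by exact_mod_cast hmn
    have hm : (0 : ℝ) ≤ m := m.cast_nonneg
    refine ODE_solution_unique_of_mem_Ioo (v := fun _ => g) (s := fun _ => univ) (K := K) (t₀ := 0)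
      (fun _ _ => hg.lipschitzOnWith) (by constructor <;> linarith)
      (fun t ht => ⟨hα m t ht, mem_univ _⟩) (fun t ht => ⟨hα n t ⟨?_, ?_⟩, mem_univ _⟩) ?_
    · linarith [ht.1]
    · linarith [ht.2]
    · rw [h0, h0]
  have hmem : ∀ (t : ℝ) (n : ℕ), |t| ≤ n → t ∈ Ioo (-((n : ℝ) + 1)) ((n : ℝ) + 1) := by
    intro t n h
    rw [abs_le] at h
    constructor <;> linarith [h.1, h.2]
  -- The index jumps with `t`, but all `s` near `t` have `⌈|s|⌉₊ ≤ ⌈|t|⌉₊ + 1`, so locally the glued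
  -- curve is the single solution with that larger index.
  refine ⟨fun t => α ⌈|t|⌉₊ t, h0 _, fun t => ?_⟩
  have hev : (fun s => α ⌈|s|⌉₊ s) =ᶠ[𝓝 t] α (⌈|t|⌉₊ + 1) := by
    have : ∀ᶠ s in 𝓝 t, |s| < |t| + 1 :=
      (continuous_abs.tendsto t).eventually (gt_mem_nhds (by linarith))
    filter_upwards [this] with s hs
    refine huniq _ _ (Nat.ceil_le.2 ?_) (hmem _ _ (Nat.le_ceil _))
    push_cast
    linarith [Nat.le_ceil |t|]
  have hlt : |t| ≤ (⌈|t|⌉₊ + 1 : ℕ) := by push_cast; linarith [Nat.le_ceil |t|]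
  have := (hα (⌈|t|⌉₊ + 1) t (hmem _ _ hlt)).congr_of_eventuallyEq hev
  rw [← hev.self_of_nhds] at this
  exact this

/-- A bounded Lipschitz vector field has a global flow. -/
theorem LipschitzWith.exists_isGlobalFlow [CompleteSpace E] (hg : LipschitzWith K g)
    (hC : ∀ x, ‖g x‖ ≤ C) : ∃ Ψ : ℝ → E → E, IsGlobalFlow g Ψ := by
  choose γ h0 hγ using hg.exists_isIntegralCurve hC
  exact ⟨fun t x => γ x t, h0, hγ⟩

namespace IsGlobalFlow

theorem hasDerivAt (hΨ : IsGlobalFlow g Ψ) (x : E) (t : ℝ) :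
    HasDerivAt (fun s => Ψ s x) (g (Ψ t x)) t :=
  hΨ.isIntegralCurve x t

theorem continuous_time (hΨ : IsGlobalFlow g Ψ) (x : E) : Continuous fun t => Ψ t x :=
  (hΨ.isIntegralCurve x).continuous

theorem map_add (hΨ : IsGlobalFlow g Ψ) (hg : LipschitzWith K g) (s t : ℝ) (x : E) :
    Ψ (s + t) x = Ψ s (Ψ t x) := by
  have h := ODE_solution_unique_univ (v := fun _ => g) (s := fun _ => univ) (K := K) (t₀ := 0)
    (f := fun s => Ψ (s + t) x) (g := fun s => Ψ s (Ψ t x)) (fun _ => hg.lipschitzOnWith)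
    (fun s => ⟨(hΨ.hasDerivAt x (s + t)).comp_add_const s t, mem_univ _⟩)
    (fun s => ⟨hΨ.hasDerivAt _ s, mem_univ _⟩) (by simp [hΨ.zero])
  exact congrFun h s

/-- Grönwall's estimate for the flow. -/
theorem dist_le (hΨ : IsGlobalFlow g Ψ) (hg : LipschitzWith K g) {t : ℝ} (ht : 0 ≤ t) (x y : E) :
    dist (Ψ t x) (Ψ t y) ≤ Real.exp (K * t) * dist x y := by
  have := dist_le_of_trajectories_ODE (v := fun _ => g) (K := K) (a := 0) (b := t)
    (f := fun s => Ψ s x) (g := fun s => Ψ s y) (δ := dist x y) (fun _ => hg)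
    (hΨ.continuous_time x).continuousOn (fun s _ => (hΨ.hasDerivAt x s).hasDerivWithinAt)
    (hΨ.continuous_time y).continuousOn (fun s _ => (hΨ.hasDerivAt y s).hasDerivWithinAt)
    (by simp [hΨ.zero]) t ⟨ht, le_rfl⟩
  rwa [sub_zero, mul_comm] at this

theorem lipschitzWith (hΨ : IsGlobalFlow g Ψ) (hg : LipschitzWith K g) {t : ℝ} (ht : 0 ≤ t) :
    LipschitzWith (Real.exp (K * t)).toNNReal (Ψ t) :=
  LipschitzWith.of_dist_le_mul fun x y => by
    rw [Real.coe_toNNReal _ (Real.exp_pos _).le]; exact hΨ.dist_le hg ht x y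

theorem dist_self_le (hΨ : IsGlobalFlow g Ψ) (hC : ∀ x, ‖g x‖ ≤ C) {t : ℝ} (ht : 0 ≤ t) (x : E) :
    dist (Ψ t x) x ≤ C * t := by
  have := norm_image_sub_le_of_norm_deriv_right_le_segment (a := 0) (b := t)
    (hΨ.continuous_time x).continuousOn (fun s _ => (hΨ.hasDerivAt x s).hasDerivWithinAt)
    (fun s _ => hC _) t ⟨ht, le_rfl⟩
  rwa [hΨ.zero, sub_zero, ← dist_eq_norm] at this

end IsGlobalFlow

end GlobalFlow

/-! ### Smooth approximation of derivatives along a flow -/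

section Mollification

variable {E : Type*} [NormedAddCommGroup E] [NormedSpace ℝ E] [FiniteDimensional ℝ E]

/-- If a continuous function `u` increases along the segments in direction `F x` near `x` at
a rate within `δ` of `w x`, then so does a mollification of `u`. -/
theorem exists_contDiff_abs_fderiv_sub_le_of_continuous {u : E → ℝ} (hu : Continuous u) {F : E → E}
    {w : E → ℝ} {δ ε : ℝ} (hδ : 0 ≤ δ) (hε : 0 < ε)
    (h : ∀ x z, dist z x < ε → ∀ s, 0 < s → s < ε → |u (z + s • F x) - u z - s * w x| ≤ δ * s) :
    ∃ v : E → ℝ, ContDiff ℝ ∞ v ∧ ∀ x, |fderiv ℝ v x (F x) - w x| ≤ δ := by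
  borelize E
  let μ : Measure E := Measure.addHaar
  let φ : ContDiffBump (0 : E) := ⟨ε / 2, ε, by positivity, by linarith⟩
  let η : E → ℝ := φ.normed μ
  have hηc : HasCompactSupport η := φ.hasCompactSupport_normed
  have hηcont : Continuous η := φ.continuous_normed
  let v : E → ℝ := convolution η u (ContinuousLinearMap.lsmul ℝ ℝ) μ
  have hv : ContDiff ℝ ∞ v :=
    hηc.contDiff_convolution_left _ φ.contDiff_normed hu.locallyIntegrable
  refine ⟨v, hv, fun x => ?_⟩
  -- The direction is frozen at `F x`, so the increment of `v` at `x` is a weighted average of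
  -- increments of `u` at points `z` in the `ε`-ball, all obeying the same bound.
  have hstep : ∀ s, 0 < s → s < ε → |v (x + s • F x) - v x - s * w x| ≤ δ * s := by
    intro s hs hsε
    have hk : Continuous fun z => u (z + s • F x) - u z := by fun_prop
    have h1 : v (x + s • F x) - v x
        = convolution η (fun z => u (z + s • F x) - u z) (ContinuousLinearMap.lsmul ℝ ℝ) μ x := by
      have e1 := hηc.convolutionExists_left (ContinuousLinearMap.lsmul ℝ ℝ) hηcont
        hu.locallyIntegrable (μ := μ)
      simp only [v, convolution_def]
      rw [← integral_sub (e1 _) (e1 _)]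
      congr 1
      ext y
      rw [← map_sub]
      congr 3
      abel_nf
    have h2 := dist_convolution_le (x₀ := x) (R := ε) (z₀ := s * w x) (ε := δ * s) (μ := μ)
      (by positivity) (φ.support_normed_eq (μ := μ)).subset φ.nonneg_normed φ.integral_normed
      hk.aestronglyMeasurable (fun z hz => by
        rw [Real.dist_eq]; exact h x z hz s hs hsε)
    rw [Real.dist_eq] at h2
    rw [h1]
    exact h2
  have hline : HasDerivAt (fun s : ℝ => v (x + s • F x)) (fderiv ℝ v x (F x)) 0 := by
    have h1 : HasDerivAt (fun s : ℝ => x + s • F x) (F x) 0 := by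
      simpa using ((hasDerivAt_id (0 : ℝ)).smul_const (F x)).const_add x
    have h2 : HasFDerivAt v (fderiv ℝ v x) (x + (0 : ℝ) • F x) := by
      simpa using (hv.differentiable (by simp) x).hasFDerivAt
    exact h2.comp_hasDerivAt 0 h1
  have htend := hline.tendsto_slope_zero_right
  refine le_of_tendsto (htend.sub_const (w x)).abs ?_
  filter_upwards [Ioo_mem_nhdsGT hε] with s hs
  have := hstep s hs.1 hs.2
  simp only [zero_add, zero_smul, add_zero, smul_eq_mul]
  have e : s⁻¹ * (v (x + s • F x) - v x) - w x = s⁻¹ * (v (x + s • F x) - v x - s * w x) := by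
    rw [mul_sub _ _ (s * w x), inv_mul_cancel_left₀ hs.1.ne']
  rw [e, abs_mul, abs_of_pos (inv_pos.2 hs.1), inv_mul_le_iff₀ hs.1, mul_comm s δ]
  exact this

/-- Let `W` be the derivative of a Lipschitz function `u` along the flow of `g`. If `W` is uniformly
continuous, then it is uniformly close to the derivative along `g` of a smooth function. -/
theorem IsGlobalFlow.exists_contDiff_abs_fderiv_sub_le {g : E → E} {Ψ : ℝ → E → E}
    (hΨ : IsGlobalFlow g Ψ) {K C L : ℝ≥0} (hg : LipschitzWith K g) (hC : ∀ x, ‖g x‖ ≤ C)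
    {u W : E → ℝ} (hu : LipschitzWith L u) (hW : UniformContinuous W)
    (h : ∀ z r, HasDerivAt (fun r => u (Ψ r z)) (W (Ψ r z)) r) {δ : ℝ} (hδ : 0 < δ) :
    ∃ v : E → ℝ, ContDiff ℝ ∞ v ∧ ∀ x, |fderiv ℝ v x (g x) - W x| ≤ δ := by
  obtain ⟨η, hη, hWη⟩ := Metric.uniformContinuous_iff.1 hW (δ / 2) (by positivity)
  -- The first bound keeps `Ψ r z` within `η` of `x`, where `W` varies by less than `δ / 2`. The
  -- second makes replacing the flow by the segment `z + s • g x` cost at most `δ / 2 * s` in `u`.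
  set ε : ℝ := min (η / (2 * (C + 1))) (δ / (2 * ((L * K + 1) * (C + 1)))) with hε
  have hε0 : 0 < ε := by positivity
  have hε1 : (C + 1) * ε < η := by
    have : ε ≤ η / (2 * (C + 1)) := min_le_left _ _
    rw [le_div_iff₀ (by positivity)] at this
    nlinarith
  have hε2 : L * (K * ((C + 1) * ε)) ≤ δ / 2 := by
    have : ε ≤ δ / (2 * ((L * K + 1) * (C + 1))) := min_le_right _ _
    rw [le_div_iff₀ (by positivity)] at this
    have h0 : 0 ≤ (C + 1) * ε := by positivity
    nlinarith
  refine exists_contDiff_abs_fderiv_sub_le_of_continuous hu.continuous hδ.le hε0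
    fun x z hz s hs hsε => ?_
  have hnear : ∀ r ∈ Ico 0 s, dist (Ψ r z) x ≤ (C + 1) * ε := by
    intro r hr
    have h1 := hΨ.dist_self_le hC hr.1 z
    have h2 : (C : ℝ) * r ≤ C * ε := by gcongr; linarith [hr.2]
    linarith [dist_triangle (Ψ r z) z x]
  have h1 : ‖Ψ s z - s • g x - z‖ ≤ K * ((C + 1) * ε) * s := by
    have hd : ∀ r, HasDerivAt (fun r => Ψ r z - r • g x) (g (Ψ r z) - g x) r := fun r => by
      simpa using (hΨ.hasDerivAt z r).fun_sub ((hasDerivAt_id r).smul_const (g x))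
    have := norm_image_sub_le_of_norm_deriv_right_le_segment (a := 0) (b := s)
      (fun r _ => (hd r).continuousAt.continuousWithinAt) (fun r _ => (hd r).hasDerivWithinAt)
      (C := K * ((C + 1) * ε)) (fun r hr => by
        rw [← dist_eq_norm]
        exact (hg.dist_le_mul _ _).trans (by gcongr; exact hnear r hr)) s ⟨hs.le, le_rfl⟩
    simpa [hΨ.zero] using this
  have h2 : ‖u (Ψ s z) - s * W x - u z‖ ≤ δ / 2 * s := by
    have hd : ∀ r, HasDerivAt (fun r => u (Ψ r z) - r * W x) (W (Ψ r z) - W x) r := fun r => by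
      simpa using (h z r).fun_sub ((hasDerivAt_id r).mul_const (W x))
    have := norm_image_sub_le_of_norm_deriv_right_le_segment (a := 0) (b := s)
      (fun r _ => (hd r).continuousAt.continuousWithinAt) (fun r _ => (hd r).hasDerivWithinAt)
      (C := δ / 2) (fun r hr => by
        rw [← dist_eq_norm]
        exact (hWη ((hnear r hr).trans_lt hε1)).le) s ⟨hs.le, le_rfl⟩
    simpa [hΨ.zero] using this
  have h3 : |u (z + s • g x) - u (Ψ s z)| ≤ δ / 2 * s := by
    rw [← Real.dist_eq, dist_comm]
    refine (hu.dist_le_mul _ _).trans ?_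
    rw [dist_eq_norm, sub_add_eq_sub_sub_swap]
    calc (L : ℝ) * ‖Ψ s z - s • g x - z‖ ≤ L * (K * ((C + 1) * ε) * s) := by gcongr
      _ = L * (K * ((C + 1) * ε)) * s := by ring
      _ ≤ δ / 2 * s := by gcongr
  rw [Real.norm_eq_abs] at h2
  calc |u (z + s • g x) - u z - s * W x|
      = |(u (z + s • g x) - u (Ψ s z)) + (u (Ψ s z) - s * W x - u z)| := by congr 1; ring
    _ ≤ δ / 2 * s + δ / 2 * s := (abs_add_le _ _).trans (add_le_add h3 h2)
    _ = δ * s := by ring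

end Mollification

/-! ### Test functions for divergence-free measures -/

section DivFree

variable {d : ℕ} {f : PhaseSpace d → PhaseSpace d} {B : Set (PhaseSpace d)}

theorem orbitalDeriv_eq_fderiv (f : PhaseSpace d → PhaseSpace d) (V : PhaseSpace d → ℝ)
    (x : PhaseSpace d) : orbitalDeriv f V x = fderiv ℝ V x (f x) := by
  rw [orbitalDeriv, gradient, real_inner_comm, InnerProductSpace.toDual_symm_apply]

theorem continuousOn_orbitalDeriv (hf : Continuous f) {V : PhaseSpace d → ℝ}
    (hV : V ∈ auxFunctions B) : ContinuousOn (orbitalDeriv f V) B := by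
  obtain ⟨U, hU, hBU, hV⟩ := hV
  have h : ContinuousOn (fun x => fderiv ℝ V x (f x)) U :=
    (hV.continuousOn_fderiv_of_isOpen hU le_rfl).clm_apply hf.continuousOn
  exact (h.mono hBU).congr fun x _ => orbitalDeriv_eq_fderiv f V x

theorem ContDiff.mem_auxFunctions {V : PhaseSpace d → ℝ} (hV : ContDiff ℝ 1 V) :
    V ∈ auxFunctions B :=
  ⟨univ, isOpen_univ, subset_univ _, hV.contDiffOn⟩

theorem orbitalDeriv_congr {V V' : PhaseSpace d → ℝ} {x : PhaseSpace d} (h : V =ᶠ[𝓝 x] V') :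
    orbitalDeriv f V x = orbitalDeriv f V' x := by
  rw [orbitalDeriv_eq_fderiv, orbitalDeriv_eq_fderiv, h.fderiv_eq]

/-- A continuously differentiable function near `B` coincides near `B` with a compactly supported
continuously differentiable function. -/
theorem exists_hasCompactSupport_of_mem_auxFunctions (hB : IsCompact B) {V : PhaseSpace d → ℝ}
    (hV : V ∈ auxFunctions B) :
    ∃ u : PhaseSpace d → ℝ, ContDiff ℝ 1 u ∧ HasCompactSupport u ∧ ∀ x ∈ B, u =ᶠ[𝓝 x] V := by
  obtain ⟨U, hU, hBU, hV⟩ := hV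
  obtain ⟨χ, hχ, hχc, hχU, hχ1⟩ := exists_contDiff_cutoff hB hU hBU
  refine ⟨fun x => χ x * V x, ?_, hχc.mul_right, fun x hx => ?_⟩
  · rw [contDiff_iff_contDiffAt]
    intro x
    by_cases hx : x ∈ U
    · exact (hχ.contDiffAt.of_le (by simp)).mul (hV.contDiffAt (hU.mem_nhds hx))
    · have : (fun x => χ x * V x) =ᶠ[𝓝 x] fun _ => 0 := by
        filter_upwards [notMem_tsupport_iff_eventuallyEq.1 (fun h => hx (hχU h))] with y hy
        simp [hy]
      exact contDiffAt_const.congr_of_eventuallyEq this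
  · filter_upwards [eventually_nhdsSet_iff_forall.1 hχ1 x hx] with y hy
    simp [hy]

theorem integrable_of_continuousOn (hB : IsCompact B) {h : PhaseSpace d → ℝ}
    (hh : ContinuousOn h B) (μ : ProbabilityMeasure B) :
    Integrable (fun x : B => h x) (μ : Measure B) := by
  have : CompactSpace B := isCompact_iff_compactSpace.1 hB
  exact (continuousOn_iff_continuous_domRestrict.1 hh).integrable_of_hasCompactSupport
    (HasCompactSupport.of_compactSpace _)

/-- Only the germ of `v` along `B` matters, so multiplying by a cutoff supplies the compact support.
Mollified functions need this, as they have no compact support in general. -/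
theorem IsWeaklyDivFree.integral_orbitalDeriv_of_contDiff (hB : IsCompact B)
    {μ : ProbabilityMeasure B} (hμ : IsWeaklyDivFree f μ) {v : PhaseSpace d → ℝ}
    (hv : ContDiff ℝ ∞ v) : ∫ x : B, orbitalDeriv f v x ∂(μ : Measure B) = 0 := by
  obtain ⟨χ, hχ, hχc, -, hχ1⟩ := exists_contDiff_cutoff hB isOpen_univ (subset_univ B)
  rw [← hμ _ (hχ.mul hv) (hχc.mul_right)]
  congr 1
  ext x
  refine orbitalDeriv_congr ?_
  filter_upwards [eventually_nhdsSet_iff_forall.1 hχ1 x x.2] with y hy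
  simp [hy]

/-- A weakly divergence-free measure annihilates the derivatives along the flow of Lipschitz
functions, when they are uniformly continuous. -/
theorem IsWeaklyDivFree.integral_eq_zero (hB : IsCompact B) (hf : Continuous f)
    {μ : ProbabilityMeasure B} (hμ : IsWeaklyDivFree f μ) {g : PhaseSpace d → PhaseSpace d}
    (hfg : EqOn f g B) {Ψ : ℝ → PhaseSpace d → PhaseSpace d}
    (hΨ : IsGlobalFlow g Ψ) {K C L : ℝ≥0} (hg : LipschitzWith K g) (hC : ∀ x, ‖g x‖ ≤ C)
    {u W : PhaseSpace d → ℝ} (hu : LipschitzWith L u) (hW : UniformContinuous W)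
    (h : ∀ z r, HasDerivAt (fun r => u (Ψ r z)) (W (Ψ r z)) r) :
    ∫ x : B, W x ∂(μ : Measure B) = 0 := by
  rw [← abs_nonpos_iff]
  refine le_of_forall_pos_le_add fun δ hδ => ?_
  obtain ⟨v, hv, hvW⟩ := hΨ.exists_contDiff_abs_fderiv_sub_le hg hC hu hW h hδ
  have hv1 : v ∈ auxFunctions B := (hv.of_le (by simp)).mem_auxFunctions
  have h0 := hμ.integral_orbitalDeriv_of_contDiff hB hv
  rw [zero_add, ← sub_zero (∫ x : B, W x ∂(μ : Measure B)), ← h0,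
    ← integral_sub (integrable_of_continuousOn hB hW.continuous.continuousOn μ)
      (integrable_of_continuousOn hB (continuousOn_orbitalDeriv hf hv1) μ), ← Real.norm_eq_abs]
  have := norm_integral_le_of_norm_le_const (μ := (μ : Measure B)) (C := δ)
    (f := fun x : B => W x - orbitalDeriv f v x) (ae_of_all _ fun x => ?_)
  · simpa using this
  · rw [Real.norm_eq_abs, abs_sub_comm, orbitalDeriv_eq_fderiv, hfg x.2]
    exact hvW x

end DivFree

/-! ### The flow on `B`; invariant versus divergence-free measures -/

section Flow

variable {d : ℕ} {f g : PhaseSpace d → PhaseSpace d} {B : Set (PhaseSpace d)}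
  {φ : ℝ≥0 → B → B} {Ψ : ℝ → PhaseSpace d → PhaseSpace d} {K C : ℝ≥0}

/-- `Ψ` is the global flow of a bounded Lipschitz vector field `g` that coincides with `f` near
`B`. -/
structure IsCutoffFlow (f : PhaseSpace d → PhaseSpace d) (B : Set (PhaseSpace d))
    (g : PhaseSpace d → PhaseSpace d) (Ψ : ℝ → PhaseSpace d → PhaseSpace d) (K C : ℝ≥0) :
    Prop where
  eventually_eq : ∀ᶠ x in 𝓝ˢ B, f x = g x
  lipschitzWith : LipschitzWith K g
  norm_le : ∀ x, ‖g x‖ ≤ C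
  isGlobalFlow : IsGlobalFlow g Ψ

theorem exists_isCutoffFlow (hf : ContDiff ℝ 1 f) (hB : IsCompact B) :
    ∃ g Ψ K C, IsCutoffFlow f B g Ψ K C := by
  obtain ⟨χ, hχ, hχc, -, hχ1⟩ := exists_contDiff_cutoff hB isOpen_univ (subset_univ B)
  have hg : ContDiff ℝ 1 fun x => χ x • f x := (hχ.of_le (by simp)).smul hf
  have hgc : HasCompactSupport fun x => χ x • f x := hχc.smul_right
  obtain ⟨K, hK⟩ := ContDiff.lipschitzWith_of_hasCompactSupport hgc hg one_ne_zero
  obtain ⟨C, hC⟩ := hgc.exists_bound_of_continuous hg.continuous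
  have hC' : ∀ x, ‖χ x • f x‖ ≤ C.toNNReal := fun x => (hC x).trans (Real.le_coe_toNNReal C)
  obtain ⟨Ψ, hΨ⟩ := hK.exists_isGlobalFlow hC'
  refine ⟨_, Ψ, K, _, ?_, hK, hC', hΨ⟩
  filter_upwards [hχ1] with x hx
  simp [hx]

theorem IsCutoffFlow.eqOn (h : IsCutoffFlow f B g Ψ K C) : EqOn f g B :=
  fun _ hx => (eventually_nhdsSet_iff_forall.1 h.eventually_eq _ hx).self_of_nhds

/-- Continuous induction in time. A point of `B` has a neighbourhood where `f = g`, so for a short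
time the curve solves the equation of `f` and is trapped; the set of good times is closed because
`B` is. -/
theorem IsCutoffFlow.mem (h : IsCutoffFlow f B g Ψ K C) (hBc : IsClosed B)
    (hB : TrapsTrajectories f B) {x : PhaseSpace d} (hx : x ∈ B) {t : ℝ} (ht : 0 ≤ t) :
    Ψ t x ∈ B := by
  have hΨ := h.isGlobalFlow
  suffices hsub : Icc 0 t ⊆ {s | Ψ s x ∈ B} from hsub ⟨ht, le_rfl⟩
  refine IsClosed.Icc_subset_of_forall_mem_nhdsWithin
    ((hBc.preimage (hΨ.continuous_time x)).inter isClosed_Icc) (by simpa [hΨ.zero] using hx) ?_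
  rintro s ⟨hs, -⟩
  have hev : ∀ᶠ r in 𝓝 (0 : ℝ), f (Ψ r (Ψ s x)) = g (Ψ r (Ψ s x)) := by
    have h1 := eventually_nhdsSet_iff_forall.1 h.eventually_eq _ hs
    have h2 := (hΨ.continuous_time (Ψ s x)).tendsto 0
    rw [hΨ.zero] at h2
    exact h2.eventually h1
  obtain ⟨δ, hδ, hball⟩ := Metric.eventually_nhds_iff_ball.1 hev
  have hcurve : IsIntegralCurveOn (fun r => Ψ r (Ψ s x)) (fun _ => f) (Icc 0 (δ / 2)) := by
    intro r hr
    have : f (Ψ r (Ψ s x)) = g (Ψ r (Ψ s x)) := hball r (by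
      rw [Metric.mem_ball, Real.dist_eq, sub_zero, abs_of_nonneg hr.1]; linarith [hr.2])
    simp only [this]
    exact (hΨ.hasDerivAt _ r).hasDerivWithinAt
  have hmem := hB _ _ hcurve (by simpa [hΨ.zero] using hs)
  filter_upwards [Ioo_mem_nhdsGT (show s < s + δ / 2 by linarith)] with r hr
  have := hmem (r - s) ⟨by linarith [hr.1], by linarith [hr.2]⟩
  rwa [← hΨ.map_add h.lipschitzWith, sub_add_cancel] at this

theorem IsFlowOn.hasDerivWithinAt (hφ : IsFlowOn f B φ) (x : B) {t : ℝ} (ht : 0 ≤ t) :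
    HasDerivWithinAt (fun t : ℝ => (φ t.toNNReal x : PhaseSpace d)) (f (φ t.toNNReal x)) (Ici t)
      t :=
  ((hφ x).2 t ht).mono (Ici_subset_Ici.2 ht)

/-- Since `φ` takes values in `B`, where `f = g`, it solves the equation of `g`, whose solutions are
unique. This carries the estimates for `Ψ` over to `φ`. -/
theorem IsFlowOn.eq_globalFlow (hφ : IsFlowOn f B φ) (h : IsCutoffFlow f B g Ψ K C) (t : ℝ≥0)
    (x : B) : (φ t x : PhaseSpace d) = Ψ t x := by
  have hΨ := h.isGlobalFlow
  have := ODE_solution_unique (v := fun _ => g) (K := K) (a := 0) (b := (t : ℝ))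
    (f := fun t : ℝ => (φ t.toNNReal x : PhaseSpace d)) (g := fun t => Ψ t x)
    (fun _ => h.lipschitzWith) ((hφ x).2.continuousOn.mono Icc_subset_Ici_self)
    (fun s hs => by
      rw [← h.eqOn (φ s.toNNReal x).2]
      exact hφ.hasDerivWithinAt x hs.1)
    (hΨ.continuous_time _).continuousOn (fun s _ => (hΨ.hasDerivAt _ s).hasDerivWithinAt)
    (by simp [hΨ.zero, (hφ x).1]) (x := (t : ℝ)) ⟨t.2, le_rfl⟩
  simpa using this

theorem existsUnique_isFlowOn (hf : ContDiff ℝ 1 f) (hBc : IsCompact B)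
    (hB : TrapsTrajectories f B) : ∃! φ : ℝ≥0 → B → B, IsFlowOn f B φ := by
  obtain ⟨g, Ψ, K, C, h⟩ := exists_isCutoffFlow hf hBc
  have hΨ := h.isGlobalFlow
  refine ⟨fun t x => ⟨Ψ t x, h.mem hBc.isClosed hB x.2 t.2⟩, fun x => ⟨?_, fun t ht => ?_⟩,
    fun φ hφ => ?_⟩
  · ext1
    simp [hΨ.zero]
  · have ht' : 0 ≤ t := ht
    have hfg := h.eqOn (h.mem hBc.isClosed hB x.2 ht')
    simp only [Real.coe_toNNReal _ ht', hfg]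
    refine (hΨ.hasDerivAt x t).hasDerivWithinAt.congr (fun s hs => ?_) ?_
    · simp only [Real.coe_toNNReal _ (show 0 ≤ s from hs)]
    · simp only [Real.coe_toNNReal _ ht']
  · ext t x : 3
    exact hφ.eq_globalFlow h t x

theorem IsFlowOn.continuous (hφ : IsFlowOn f B φ) (hf : ContDiff ℝ 1 f) (hBc : IsCompact B) :
    Continuous fun p : ℝ≥0 × B => φ p.1 p.2 := by
  obtain ⟨g, Ψ, K, C, h⟩ := exists_isCutoffFlow hf hBc
  have hΨ := h.isGlobalFlow
  rw [continuous_induced_rng]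
  -- The Lipschitz constant in time is the speed bound `C`, uniform over starting points.
  refine continuous_prod_of_continuous_lipschitzWith _ C (fun t => ?_) (fun x => ?_)
  · simp only [Function.comp_apply, hφ.eq_globalFlow h]
    exact (hΨ.lipschitzWith h.lipschitzWith t.2).continuous.comp continuous_subtype_val
  · simp only [Function.comp_apply, hφ.eq_globalFlow h]
    have h1 : LipschitzWith C fun t => Ψ t x :=
      lipschitzWith_of_nnnorm_deriv_le (fun t => (hΨ.hasDerivAt x t).differentiableAt) fun t => by
        rw [(hΨ.hasDerivAt x t).deriv]
        exact h.norm_le _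
    exact (h1.comp (LipschitzWith.subtype_val _)).weaken (by simp)

theorem IsFlowOn.hasDerivWithinAt_comp (hφ : IsFlowOn f B φ) {V : PhaseSpace d → ℝ}
    (hV : V ∈ auxFunctions B) (x : B) {t : ℝ} (ht : 0 ≤ t) :
    HasDerivWithinAt (fun t : ℝ => V (φ t.toNNReal x)) (orbitalDeriv f V (φ t.toNNReal x)) (Ici t)
      t := by
  obtain ⟨U, hU, hBU, hV⟩ := hV
  have h1 : HasFDerivAt V (fderiv ℝ V (φ t.toNNReal x)) (φ t.toNNReal x) :=
    ((hV.contDiffAt (hU.mem_nhds (hBU (φ t.toNNReal x).2))).differentiableAt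
      one_ne_zero).hasFDerivAt
  rw [orbitalDeriv_eq_fderiv]
  exact h1.comp_hasDerivWithinAt t (hφ.hasDerivWithinAt x ht)

theorem continuous_restrict_of_mem_auxFunctions {V : PhaseSpace d → ℝ}
    (hV : V ∈ auxFunctions B) : Continuous fun x : B => V x := by
  obtain ⟨U, -, hBU, hV⟩ := hV
  exact continuousOn_iff_continuous_domRestrict.1 (hV.continuousOn.mono hBU)

theorem continuous_restrict_orbitalDeriv (hf : ContDiff ℝ 1 f) {V : PhaseSpace d → ℝ}
    (hV : V ∈ auxFunctions B) : Continuous fun x : B => orbitalDeriv f V x :=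
  continuousOn_iff_continuous_domRestrict.1 (continuousOn_orbitalDeriv hf.continuous hV)

/-- The fundamental theorem of calculus along trajectories. -/
theorem IsFlowOn.integral_orbitalDeriv (hφ : IsFlowOn f B φ) (hf : ContDiff ℝ 1 f)
    (hBc : IsCompact B) {V : PhaseSpace d → ℝ} (hV : V ∈ auxFunctions B) (x : B) {T : ℝ}
    (hT : 0 ≤ T) :
    ∫ t in (0 : ℝ)..T, orbitalDeriv f V (φ t.toNNReal x) = V (φ T.toNNReal x) - V x := by
  have hc : Continuous fun t : ℝ => φ t.toNNReal x :=
    (hφ.continuous hf hBc).comp (continuous_real_toNNReal.prodMk continuous_const)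
  rw [intervalIntegral.integral_eq_sub_of_hasDeriv_right_of_le hT
    (f := fun t : ℝ => V (φ t.toNNReal x))
    ((continuous_restrict_of_mem_auxFunctions hV).comp hc).continuousOn
    (fun t ht => (hφ.hasDerivWithinAt_comp hV x ht.1.le).mono Ioi_subset_Ici_self)
    (((continuous_restrict_orbitalDeriv hf hV).comp hc).intervalIntegrable _ _)]
  simp [(hφ x).1]

theorem Continuous.integrable_of_isCompact (hBc : IsCompact B) {h : B → ℝ} (hh : Continuous h)
    (μ : Measure B) [IsFiniteMeasure μ] : Integrable h μ := by
  have : CompactSpace B := isCompact_iff_compactSpace.1 hBc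
  exact hh.integrable_of_hasCompactSupport (HasCompactSupport.of_compactSpace _)

/-- Fubini's theorem for time and space averages of an observable. -/
theorem IsFlowOn.integral_integral_swap (hφ : IsFlowOn f B φ) (hf : ContDiff ℝ 1 f)
    (hBc : IsCompact B) {h : B → ℝ} (hh : Continuous h) (μ : Measure B) [IsFiniteMeasure μ]
    (T : ℝ) :
    ∫ t in (0 : ℝ)..T, (∫ x, h (φ t.toNNReal x) ∂μ)
      = ∫ x, (∫ t in (0 : ℝ)..T, h (φ t.toNNReal x)) ∂μ := by
  have : CompactSpace B := isCompact_iff_compactSpace.1 hBc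
  have hc : Continuous (Function.uncurry fun (t : ℝ) (x : B) => h (φ t.toNNReal x)) :=
    hh.comp ((hφ.continuous hf hBc).comp
      ((continuous_real_toNNReal.comp continuous_fst).prodMk continuous_snd))
  obtain ⟨M, hM⟩ : ∃ M, ∀ x, ‖h x‖ ≤ M := by
    obtain ⟨M, hM⟩ := isCompact_univ.exists_bound_of_continuousOn hh.continuousOn
    exact ⟨M, fun x => hM x (mem_univ x)⟩
  refine intervalIntegral_integral_swap ?_
  have : IsFiniteMeasure (volume.restrict (uIoc 0 T)) := ⟨by simp [uIoc]⟩
  exact Integrable.of_bound hc.aestronglyMeasurable M (ae_of_all _ fun p => hM _)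

/-- Both directions of the equivalence between invariance and zero divergence rest on this identity:
invariance kills the left side and makes the integrand on the right constant in time, while zero
divergence kills the right side. -/
theorem IsFlowOn.integral_comp_sub (hφ : IsFlowOn f B φ) (hf : ContDiff ℝ 1 f)
    (hBc : IsCompact B) {V : PhaseSpace d → ℝ} (hV : V ∈ auxFunctions B) (μ : Measure B)
    [IsFiniteMeasure μ] (T : ℝ≥0) :
    ∫ x, V (φ T x) ∂μ - ∫ x : B, V x ∂μ
      = ∫ t in (0 : ℝ)..T, (∫ x, orbitalDeriv f V (φ t.toNNReal x) ∂μ) := by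
  have hVc := continuous_restrict_of_mem_auxFunctions hV
  have hVT : Continuous fun x => V (φ T x) :=
    hVc.comp ((hφ.continuous hf hBc).comp (continuous_const.prodMk continuous_id))
  rw [hφ.integral_integral_swap hf hBc (continuous_restrict_orbitalDeriv hf hV),
    ← integral_sub (hVT.integrable_of_isCompact hBc μ)
      (hVc.integrable_of_isCompact hBc μ)]
  congr 1
  ext x
  rw [hφ.integral_orbitalDeriv hf hBc hV x T.coe_nonneg]
  simp

theorem IsFlowOn.continuous_flow (hφ : IsFlowOn f B φ) (hf : ContDiff ℝ 1 f) (hBc : IsCompact B)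
    (t : ℝ≥0) : Continuous (φ t) :=
  (hφ.continuous hf hBc).comp (continuous_const.prodMk continuous_id)

theorem IsInvariantMeasure.measurePreserving {μ : ProbabilityMeasure B}
    (hμ : IsInvariantMeasure φ μ) {t : ℝ≥0} (ht : Measurable (φ t)) :
    MeasurePreserving (φ t) (μ : Measure B) μ :=
  ⟨ht, Measure.ext fun A hA => by rw [Measure.map_apply ht hA, hμ t A hA]⟩

theorem IsInvariantMeasure.integral_comp {μ : ProbabilityMeasure B}
    (hμ : IsInvariantMeasure φ μ) (hφ : IsFlowOn f B φ) (hf : ContDiff ℝ 1 f)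
    (hBc : IsCompact B) {h : B → ℝ} (hh : Continuous h) (t : ℝ≥0) :
    ∫ x, h (φ t x) ∂(μ : Measure B) = ∫ x, h x ∂(μ : Measure B) := by
  have hm := (hφ.continuous_flow hf hBc t).measurable
  have := integral_map (μ := (μ : Measure B)) hm.aemeasurable (f := h) hh.aestronglyMeasurable
  rw [← this, (hμ.measurePreserving hm).map_eq]

/-- Invariant measures annihilate orbital derivatives. -/
theorem IsInvariantMeasure.integral_orbitalDeriv {μ : ProbabilityMeasure B}
    (hμ : IsInvariantMeasure φ μ) (hφ : IsFlowOn f B φ) (hf : ContDiff ℝ 1 f)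
    (hBc : IsCompact B) {V : PhaseSpace d → ℝ} (hV : V ∈ auxFunctions B) :
    ∫ x : B, orbitalDeriv f V x ∂(μ : Measure B) = 0 := by
  have h := hφ.integral_comp_sub hf hBc hV (μ : Measure B) 1
  simp only [hμ.integral_comp hφ hf hBc (continuous_restrict_of_mem_auxFunctions hV),
    hμ.integral_comp hφ hf hBc (continuous_restrict_orbitalDeriv hf hV)] at h
  simpa using h.symm

/-- The orbital derivatives of a `C^1` function transported by the flow have zero mean with respect
to a weakly divergence-free measure. -/
theorem IsWeaklyDivFree.integral_orbitalDeriv_comp {μ : ProbabilityMeasure B}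
    (hμ : IsWeaklyDivFree f μ) (hφ : IsFlowOn f B φ) (hf : ContDiff ℝ 1 f)
    (hBc : IsCompact B) {V : PhaseSpace d → ℝ} (hV : V ∈ auxFunctions B) (t : ℝ≥0) :
    ∫ x : B, orbitalDeriv f V (φ t x) ∂(μ : Measure B) = 0 := by
  obtain ⟨g, Ψ, K, C, h⟩ := exists_isCutoffFlow hf hBc
  have hΨ := h.isGlobalFlow
  obtain ⟨u, hu, huc, huV⟩ := exists_hasCompactSupport_of_mem_auxFunctions hBc hV
  obtain ⟨L, hL⟩ := ContDiff.lipschitzWith_of_hasCompactSupport huc hu one_ne_zero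
  have hWc : Continuous fun x => fderiv ℝ u x (g x) :=
    (hu.continuous_fderiv one_ne_zero).clm_apply h.lipschitzWith.continuous
  have hWs : HasCompactSupport fun x => fderiv ℝ u x (g x) :=
    (huc.fderiv ℝ).mono fun x hx hx' => hx (by simp [hx'])
  have hflow := hΨ.lipschitzWith h.lipschitzWith t.2
  -- `u ∘ Ψ t` is only known to be Lipschitz, so it is not itself a test function. As `Ψ t` commutes
  -- with `Ψ r`, its derivative along the flow is `W`, which is uniformly continuous.
  have key := hμ.integral_eq_zero hBc hf.continuous h.eqOn hΨ h.lipschitzWith h.norm_le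
    (u := fun x => u (Ψ t x)) (W := fun x => fderiv ℝ u (Ψ t x) (g (Ψ t x))) (hL.comp hflow)
    ((hWs.uniformContinuous_of_continuous hWc).comp hflow.uniformContinuous) (fun z r => by
      simp only [← hΨ.map_add h.lipschitzWith]
      have h1 := (hΨ.hasDerivAt z (t + r)).comp_const_add (t : ℝ) r
      exact ((hu.differentiable one_ne_zero _).hasFDerivAt).comp_hasDerivAt r h1)
  rw [← key]
  congr 1
  ext x
  rw [← orbitalDeriv_congr (huV _ (φ t x).2), orbitalDeriv_eq_fderiv, h.eqOn (φ t x).2,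
    hφ.eq_globalFlow h]

/-- The case `t = 0` enlarges the class of test functions from smooth ones to all of `C^1(B)`. -/
theorem IsWeaklyDivFree.integral_orbitalDeriv {μ : ProbabilityMeasure B}
    (hμ : IsWeaklyDivFree f μ) (hφ : IsFlowOn f B φ) (hf : ContDiff ℝ 1 f)
    (hBc : IsCompact B) {V : PhaseSpace d → ℝ} (hV : V ∈ auxFunctions B) :
    ∫ x : B, orbitalDeriv f V x ∂(μ : Measure B) = 0 := by
  simpa only [(hφ _).1] using hμ.integral_orbitalDeriv_comp hφ hf hBc hV 0

/-- The cosines and sines are auxiliary functions, so integrals of auxiliary functions determine the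
characteristic function and hence the measure. -/
theorem charFun_map_subtype_val (hBc : IsCompact B) (μ : Measure B) [IsFiniteMeasure μ]
    (ξ : PhaseSpace d) : charFun (μ.map Subtype.val) ξ
      = (∫ x : B, Real.cos (inner ℝ (x : PhaseSpace d) ξ) ∂μ : ℝ)
        + (∫ x : B, Real.sin (inner ℝ (x : PhaseSpace d) ξ) ∂μ : ℝ) * Complex.I := by
  have hc : Continuous fun x : B => Real.cos (inner ℝ (x : PhaseSpace d) ξ) := by fun_prop
  have hs : Continuous fun x : B => Real.sin (inner ℝ (x : PhaseSpace d) ξ) := by fun_prop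
  rw [charFun_apply, integral_map (by fun_prop) (by fun_prop), ← integral_complex_ofReal,
    ← integral_complex_ofReal, ← integral_mul_const,
    ← integral_add (hc.integrable_of_isCompact hBc μ).ofReal
      ((hs.integrable_of_isCompact hBc μ).ofReal.mul_const _)]
  congr 1
  ext x
  rw [Complex.exp_mul_I]
  push_cast
  rfl

/-- Finite measures on `B` that agree on the auxiliary functions are equal. -/
theorem Measure.ext_of_integral_auxFunctions (hBc : IsCompact B) {μ ν : Measure B}
    [IsFiniteMeasure μ] [IsFiniteMeasure ν]
    (h : ∀ V ∈ auxFunctions B, ∫ x : B, V x ∂μ = ∫ x : B, V x ∂ν) : μ = ν := by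
  refine (MeasurableEmbedding.subtype_coe hBc.measurableSet).map_injective
    (Measure.ext_of_charFun (funext fun ξ => ?_))
  rw [charFun_map_subtype_val hBc, charFun_map_subtype_val hBc,
    h (fun x => Real.cos (inner ℝ x ξ))
      (Real.contDiff_cos.comp (contDiff_id.inner ℝ contDiff_const)).mem_auxFunctions,
    h (fun x => Real.sin (inner ℝ x ξ))
      (Real.contDiff_sin.comp (contDiff_id.inner ℝ contDiff_const)).mem_auxFunctions]

/-- A measure is invariant if and only if it is weakly divergence-free. -/
theorem isInvariantMeasure_iff_isWeaklyDivFree (hφ : IsFlowOn f B φ) (hf : ContDiff ℝ 1 f)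
    (hBc : IsCompact B) (μ : ProbabilityMeasure B) :
    IsInvariantMeasure φ μ ↔ IsWeaklyDivFree f μ := by
  refine ⟨fun hμ ψ hψ _ => hμ.integral_orbitalDeriv hφ hf hBc (hψ.of_le (by simp)).mem_auxFunctions,
    fun hμ t A hA => ?_⟩
  have hm := (hφ.continuous_flow hf hBc t).measurable
  have : IsFiniteMeasure ((μ : Measure B).map (φ t)) := inferInstance
  have hmap : (μ : Measure B).map (φ t) = μ := by
    refine Measure.ext_of_integral_auxFunctions hBc fun V hV => ?_
    have h := hφ.integral_comp_sub hf hBc hV (μ : Measure B) t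
    simp only [hμ.integral_orbitalDeriv_comp hφ hf hBc hV, intervalIntegral.integral_zero] at h
    rw [integral_map hm.aemeasurable
      (continuous_restrict_of_mem_auxFunctions hV).aestronglyMeasurable]
    exact sub_eq_zero.1 h
  rw [← Measure.map_apply hm hA, hmap]

end Flow

/-! ### Hahn–Banach duality on a compact space -/

section Duality

variable {X : Type*} [TopologicalSpace X] [CompactSpace X] [T2Space X] [MeasurableSpace X]
  [BorelSpace X]

/-- The Riesz–Markov–Kakutani theorem for normalized positive functionals on a compact space. -/
theorem exists_probabilityMeasure_integral_eq (ℓ : C(X, ℝ) →ₗ[ℝ] ℝ)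
    (hpos : ∀ h : C(X, ℝ), (∀ x, 0 ≤ h x) → 0 ≤ ℓ h) (h1 : ℓ 1 = 1) :
    ∃ μ : ProbabilityMeasure X, ∀ h : C(X, ℝ), ∫ x, h x ∂(μ : Measure X) = ℓ h := by
  let Λ : CompactlySupportedContinuousMap X ℝ →ₚ[ℝ] ℝ :=
    { toFun := fun h => ℓ h.toContinuousMap
      map_add' := fun h k => ℓ.map_add h.toContinuousMap k.toContinuousMap
      map_smul' := fun c h => ℓ.map_smul c h.toContinuousMap
      monotone' := fun h k hhk => by
        have := hpos (k.toContinuousMap - h.toContinuousMap) fun x => sub_nonneg.2 (hhk x)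
        rw [map_sub] at this
        exact sub_nonneg.1 this }
  have hint : ∀ h : C(X, ℝ), ∫ x, h x ∂(RealRMK.rieszMeasure Λ) = ℓ h := fun h =>
    RealRMK.integral_rieszMeasure Λ ⟨h, HasCompactSupport.of_compactSpace _⟩
  have hprob : IsProbabilityMeasure (RealRMK.rieszMeasure Λ) := by
    have := hint 1
    simp only [ContinuousMap.one_apply, integral_const, smul_eq_mul, mul_one, h1] at this
    exact isProbabilityMeasure_iff_real.2 this
  exact ⟨⟨_, hprob⟩, hint⟩

/-- Let `D` be a space of continuous functions on a compact space none of which is strictly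
negative. Then for each continuous `h`, the infimum over `k ∈ D` of the maximum of `h + k` is the
integral of `h` with respect to a probability measure that annihilates `D`. -/
theorem exists_probabilityMeasure_annihilating (D : Submodule ℝ C(X, ℝ))
    (hD : ∀ k ∈ D, ∃ x, 0 ≤ k x) (h : C(X, ℝ)) :
    ∃ μ : ProbabilityMeasure X, (∀ k ∈ D, ∫ x, k x ∂(μ : Measure X) = 0) ∧
      ∀ r, ∫ x, h x ∂(μ : Measure X) < r → ∃ k ∈ D, ∀ x, h x + k x ≤ r := by
  let S : C(X, ℝ) → Set ℝ := fun h => {r | ∃ k ∈ D, ∀ x, h x + k x ≤ r}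
  let N : C(X, ℝ) → ℝ := fun h => sInf (S h)
  -- At a point where `k ≥ 0`, `h + k` is at least `-‖h‖`; this makes `N` finite.
  have hbdd : ∀ h, BddBelow (S h) := by
    refine fun h => ⟨-‖h‖, ?_⟩
    rintro r ⟨k, hk, hr⟩
    obtain ⟨x, hx⟩ := hD k hk
    linarith [hr x, (abs_le.1 (h.norm_coe_le_norm x)).1]
  have hne : ∀ h, (S h).Nonempty := fun h =>
    ⟨‖h‖, 0, D.zero_mem, fun x => by simpa using (abs_le.1 (h.norm_coe_le_norm x)).2⟩
  have hle : ∀ h r, r ∈ S h → N h ≤ r := fun h r hr => csInf_le (hbdd h) hr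
  have hlt : ∀ h r, N h < r → ∃ k ∈ D, ∀ x, h x + k x ≤ r := by
    intro h r hr
    obtain ⟨r', ⟨k, hk, hr'⟩, hlt⟩ := exists_lt_of_csInf_lt (hne h) hr
    exact ⟨k, hk, fun x => (hr' x).trans hlt.le⟩
  have hadd : ∀ h k, N (h + k) ≤ N h + N k := by
    intro h k
    refine le_of_forall_pos_le_add fun ε hε => ?_
    obtain ⟨a, ha, ha'⟩ := hlt h (N h + ε / 2) (by linarith)
    obtain ⟨b, hb, hb'⟩ := hlt k (N k + ε / 2) (by linarith)
    refine hle _ _ ⟨a + b, D.add_mem ha hb, fun x => ?_⟩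
    simp only [ContinuousMap.add_apply]
    linarith [ha' x, hb' x]
  have hsmul_le : ∀ c : ℝ, 0 < c → ∀ h, N (c • h) ≤ c * N h := by
    intro c hc h
    refine le_of_forall_pos_le_add fun ε hε => ?_
    obtain ⟨a, ha, ha'⟩ := hlt h (N h + ε / c) (by linarith [div_pos hε hc])
    refine hle _ _ ⟨c • a, D.smul_mem c ha, fun x => ?_⟩
    have := mul_le_mul_of_nonneg_left (ha' x) hc.le
    rw [mul_add c (N h), mul_div_cancel₀ _ hc.ne'] at this
    simpa [mul_add] using this
  have hsmul : ∀ c : ℝ, 0 < c → ∀ h, N (c • h) = c * N h := by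
    intro c hc h
    refine le_antisymm (hsmul_le c hc h) ?_
    have := hsmul_le c⁻¹ (inv_pos.2 hc) (c • h)
    rwa [inv_smul_smul₀ hc.ne', ← div_eq_inv_mul, le_div_iff₀' hc] at this
  have hzero : N 0 = 0 := by
    have := hsmul 2 (by norm_num) 0
    rw [smul_zero] at this
    linarith
  have hline : ∀ c : ℝ, c * N h ≤ N (c • h) := by
    intro c
    rcases lt_trichotomy c 0 with hc | rfl | hc
    · have h1 := hsmul (-c) (by linarith) h
      have h2 := hadd (c • h) (-c • h)
      rw [neg_smul, add_neg_cancel, hzero, ← neg_smul, h1] at h2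
      linarith
    · simp [hzero]
    · exact (hsmul c hc h).ge
  have hwd : ∀ c : ℝ, c • h = 0 → (RingHom.id ℝ) c • N h = 0 := by
    intro c hc
    rcases smul_eq_zero.1 hc with rfl | hh
    · simp
    · rw [hh, hzero, smul_zero]
  -- Extending from the line through `h`, rather than from `0`, makes the functional attain the
  -- value `N h`.
  obtain ⟨ℓ, hℓ, hℓN⟩ := exists_extension_of_le_sublinear
    (LinearPMap.mkSpanSingleton' h (N h) hwd) N hsmul hadd (by
      rintro ⟨y, hy⟩
      obtain ⟨c, rfl⟩ := Submodule.mem_span_singleton.1 hy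
      rw [LinearPMap.mkSpanSingleton'_apply]
      exact hline c)
  have hℓh : ℓ h = N h := by
    have := hℓ ⟨h, Submodule.mem_span_singleton_self h⟩
    exact this.trans (LinearPMap.mkSpanSingleton'_apply_self _ _ _ _)
  have hℓle : ∀ k r, r ∈ S k → ℓ k ≤ r := fun k r hr => (hℓN k).trans (hle k r hr)
  obtain ⟨μ, hμ⟩ := exists_probabilityMeasure_integral_eq ℓ (fun k hk => by
    have := hℓle (-k) 0 ⟨0, D.zero_mem, fun x => by simpa using hk x⟩
    rw [map_neg] at this
    linarith) (by
    have h1 := hℓle 1 1 ⟨0, D.zero_mem, fun x => by simp⟩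
    have h2 := hℓle (-1) (-1) ⟨0, D.zero_mem, fun x => by simp⟩
    rw [map_neg] at h2
    linarith)
  -- `D` is a subspace, so `k` and `-k` can each be cancelled within `D`; hence `ℓ k ≤ 0` and `ℓ
  -- (-k) ≤ 0`.
  refine ⟨μ, fun k hk => ?_, fun r hr => hlt h r (by rwa [hμ, hℓh] at hr)⟩
  have h1 := hℓle k 0 ⟨-k, D.neg_mem hk, fun x => by simp⟩
  have h2 := hℓle (-k) 0 ⟨k, hk, fun x => by simp⟩
  rw [map_neg] at h2
  rw [hμ]
  linarith

end Duality

/-! ### Duality between invariant measures and auxiliary functions -/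

section Ergodic

variable {d : ℕ} {f : PhaseSpace d → PhaseSpace d} {B : Set (PhaseSpace d)} {φ : ℝ≥0 → B → B}

theorem orbitalDeriv_add {V V' : PhaseSpace d → ℝ} (hV : V ∈ auxFunctions B)
    (hV' : V' ∈ auxFunctions B) {x : PhaseSpace d} (hx : x ∈ B) :
    orbitalDeriv f (fun y => V y + V' y) x = orbitalDeriv f V x + orbitalDeriv f V' x := by
  obtain ⟨U, hU, hBU, hV⟩ := hV
  obtain ⟨U', hU', hBU', hV'⟩ := hV'
  have h1 := (hV.contDiffAt (hU.mem_nhds (hBU hx))).differentiableAt one_ne_zero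
  have h2 := (hV'.contDiffAt (hU'.mem_nhds (hBU' hx))).differentiableAt one_ne_zero
  simp only [orbitalDeriv_eq_fderiv]
  rw [fderiv_fun_add h1 h2, add_apply]

theorem orbitalDeriv_const_mul {V : PhaseSpace d → ℝ} (hV : V ∈ auxFunctions B) (c : ℝ)
    {x : PhaseSpace d} (hx : x ∈ B) :
    orbitalDeriv f (fun y => c * V y) x = c * orbitalDeriv f V x := by
  obtain ⟨U, hU, hBU, hV⟩ := hV
  have h1 := (hV.contDiffAt (hU.mem_nhds (hBU hx))).differentiableAt one_ne_zero
  simp only [orbitalDeriv_eq_fderiv]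
  rw [fderiv_const_mul h1, smul_apply, smul_eq_mul]

theorem add_mem_auxFunctions {V V' : PhaseSpace d → ℝ} (hV : V ∈ auxFunctions B)
    (hV' : V' ∈ auxFunctions B) : (fun y => V y + V' y) ∈ auxFunctions B := by
  obtain ⟨U, hU, hBU, hV⟩ := hV
  obtain ⟨U', hU', hBU', hV'⟩ := hV'
  exact ⟨U ∩ U', hU.inter hU', subset_inter hBU hBU',
    (hV.mono inter_subset_left).add (hV'.mono inter_subset_right)⟩

theorem const_mul_mem_auxFunctions {V : PhaseSpace d → ℝ} (hV : V ∈ auxFunctions B) (c : ℝ) :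
    (fun y => c * V y) ∈ auxFunctions B := by
  obtain ⟨U, hU, hBU, hV⟩ := hV
  exact ⟨U, hU, hBU, contDiffOn_const.mul hV⟩

/-- The orbital derivative of an auxiliary function is not everywhere negative. -/
theorem IsFlowOn.exists_orbitalDeriv_nonneg (hφ : IsFlowOn f B φ) (hBc : IsCompact B)
    (hBne : B.Nonempty) {V : PhaseSpace d → ℝ} (hV : V ∈ auxFunctions B) :
    ∃ x : B, 0 ≤ orbitalDeriv f V x := by
  have : CompactSpace B := isCompact_iff_compactSpace.1 hBc
  have : Nonempty B := hBne.to_subtype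
  -- Take `x` minimizing `V` on `B`. Its gradient need not vanish there, but the trajectory stays in
  -- `B`, so the right derivative of `V` along it at time `0` is nonnegative.
  obtain ⟨x, hx⟩ :=
    (continuous_restrict_of_mem_auxFunctions hV).exists_forall_le_of_hasCompactSupport
    (HasCompactSupport.of_compactSpace _)
  refine ⟨x, ?_⟩
  have h := (hasDerivWithinAt_iff_tendsto_slope' self_notMem_Ioi).1
    ((hφ.hasDerivWithinAt_comp hV x le_rfl).mono Ioi_subset_Ici_self)
  simp only [Real.toNNReal_zero, (hφ x).1] at h
  refine ge_of_tendsto h ?_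
  filter_upwards [self_mem_nhdsWithin] with t ht
  rw [slope_def_field]
  refine div_nonneg ?_ (sub_nonneg.2 (le_of_lt ht))
  simp only [Real.toNNReal_zero, (hφ x).1]
  exact sub_nonneg.2 (hx _)

/-- The duality between invariant measures and auxiliary functions. -/
theorem IsFlowOn.exists_isInvariantMeasure_forall_lt (hφ : IsFlowOn f B φ) (hf : ContDiff ℝ 1 f)
    (hBc : IsCompact B) (hBne : B.Nonempty) {h : B → ℝ} (hh : Continuous h) :
    ∃ μ : ProbabilityMeasure B, IsInvariantMeasure φ μ ∧
      ∀ r, ∫ x, h x ∂(μ : Measure B) < r →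
        ∃ V ∈ auxFunctions B, ∀ x : B, h x + orbitalDeriv f V x ≤ r := by
  have : CompactSpace B := isCompact_iff_compactSpace.1 hBc
  let D : Submodule ℝ C(B, ℝ) :=
    { carrier := {k | ∃ V ∈ auxFunctions B, ∀ x : B, k x = orbitalDeriv f V x}
      add_mem' := by
        rintro k k' ⟨V, hV, hk⟩ ⟨V', hV', hk'⟩
        exact ⟨_, add_mem_auxFunctions hV hV', fun x => by
          rw [orbitalDeriv_add hV hV' x.2, ContinuousMap.add_apply, hk, hk']⟩
      zero_mem' := ⟨fun _ => 0, contDiff_const.mem_auxFunctions, fun x => by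
        simp [orbitalDeriv_eq_fderiv]⟩
      smul_mem' := by
        rintro c k ⟨V, hV, hk⟩
        exact ⟨_, const_mul_mem_auxFunctions hV c, fun x => by
          rw [orbitalDeriv_const_mul hV c x.2, ContinuousMap.smul_apply, hk, smul_eq_mul]⟩ }
  obtain ⟨μ, hμ, hr⟩ := exists_probabilityMeasure_annihilating D (by
    rintro k ⟨V, hV, hk⟩
    simp only [hk]
    exact hφ.exists_orbitalDeriv_nonneg hBc hBne hV) ⟨h, hh⟩
  refine ⟨μ, (isInvariantMeasure_iff_isWeaklyDivFree hφ hf hBc μ).2 fun ψ hψ _ => ?_,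
    fun r hrlt => ?_⟩
  · have hψ' : ψ ∈ auxFunctions B := (hψ.of_le (by simp)).mem_auxFunctions
    exact hμ ⟨_, continuous_restrict_orbitalDeriv hf hψ'⟩ ⟨ψ, hψ', fun _ => rfl⟩
  · obtain ⟨k, ⟨V, hV, hk⟩, hle⟩ := hr r hrlt
    exact ⟨V, hV, fun x => by rw [← hk]; exact hle x⟩

end Ergodic

/-! ### Long-time averages against means of invariant measures -/

section LongTimeAverages

variable {d : ℕ} {f : PhaseSpace d → PhaseSpace d} {B : Set (PhaseSpace d)} {φ : ℝ≥0 → B → B}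
  {Φ : PhaseSpace d → ℝ}

theorem IsFlowOn.continuous_comp_toNNReal (hφ : IsFlowOn f B φ) (hf : ContDiff ℝ 1 f)
    (hBc : IsCompact B) {h : B → ℝ} (hh : Continuous h) (x : B) :
    Continuous fun t : ℝ => h (φ t.toNNReal x) :=
  hh.comp ((hφ.continuous hf hBc).comp (continuous_real_toNNReal.prodMk continuous_const))

theorem Continuous.exists_abs_le_of_isCompact (hBc : IsCompact B) {h : B → ℝ}
    (hh : Continuous h) : ∃ b, ∀ x, |h x| ≤ b := by
  have : CompactSpace B := isCompact_iff_compactSpace.1 hBc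
  obtain ⟨M, hM⟩ := isCompact_univ.exists_bound_of_continuousOn hh.continuousOn
  exact ⟨M, fun x => hM x (mem_univ x)⟩

/-- A pointwise upper bound for `Φ + f · ∇V` bounds the long-time averages of `Φ`. -/
theorem IsFlowOn.longTimeAverage_le (hφ : IsFlowOn f B φ) (hf : ContDiff ℝ 1 f)
    (hBc : IsCompact B) (hΦ : Continuous Φ) {V : PhaseSpace d → ℝ} (hV : V ∈ auxFunctions B)
    {r : ℝ} (hr : ∀ x : B, Φ x + orbitalDeriv f V x ≤ r) (x : B) :
    longTimeAverage Φ (fun t => (φ t x : PhaseSpace d)) ≤ r := by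
  obtain ⟨b, hb⟩ :=
    (continuous_restrict_of_mem_auxFunctions hV).exists_abs_le_of_isCompact hBc
  -- The error `2 * b / T` bounds the boundary term `(V x - V (φ_T x)) / T`, where `|V| ≤ b` on `B`.
  have htend : Tendsto (fun T : ℝ => ((r + 2 * b / T : ℝ) : EReal)) atTop (𝓝 (r : EReal)) := by
    refine (continuous_coe_real_ereal.tendsto r).comp ?_
    simpa using (tendsto_const_nhds (x := r)).add (tendsto_id.const_div_atTop (2 * b))
  rw [longTimeAverage, ← htend.limsup_eq]
  refine limsup_le_limsup ?_
  filter_upwards [eventually_gt_atTop 0] with T hT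
  rw [EReal.coe_le_coe_iff]
  have hc1 : Continuous fun t : ℝ => Φ (φ t.toNNReal x) :=
    hφ.continuous_comp_toNNReal hf hBc (hΦ.comp continuous_subtype_val) x
  have hc2 := hφ.continuous_comp_toNNReal hf hBc (continuous_restrict_orbitalDeriv hf hV) x
  have h1 : ∫ t in (0 : ℝ)..T, (Φ (φ t.toNNReal x) + orbitalDeriv f V (φ t.toNNReal x))
      ≤ ∫ _ in (0 : ℝ)..T, r :=
    intervalIntegral.integral_mono hT.le ((hc1.add hc2).intervalIntegrable _ _)
      intervalIntegrable_const fun t => hr _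
  rw [intervalIntegral.integral_add (hc1.intervalIntegrable _ _) (hc2.intervalIntegrable _ _),
    hφ.integral_orbitalDeriv hf hBc hV x hT.le, intervalIntegral.integral_const, sub_zero,
    smul_eq_mul] at h1
  have h2 := (abs_le.1 (hb (φ T.toNNReal x))).1
  have h3 := (abs_le.1 (hb x)).2
  rw [one_div, inv_mul_le_iff₀ hT, mul_add, mul_div_cancel₀ _ hT.ne']
  linarith

/-- Some long-time average is at least the mean with respect to a given invariant measure. -/
theorem IsInvariantMeasure.exists_le_longTimeAverage {μ : ProbabilityMeasure B}
    (hμ : IsInvariantMeasure φ μ) (hφ : IsFlowOn f B φ) (hf : ContDiff ℝ 1 f)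
    (hBc : IsCompact B) (hΦ : Continuous Φ) :
    ∃ x : B, ((∫ x : B, Φ x ∂(μ : Measure B) : ℝ) : EReal)
      ≤ longTimeAverage Φ (fun t => (φ t x : PhaseSpace d)) := by
  have hΦB : Continuous fun x : B => Φ x := hΦ.comp continuous_subtype_val
  obtain ⟨b, hb⟩ := hΦB.exists_abs_le_of_isCompact hBc
  set m : ℝ := ∫ x : B, Φ x ∂(μ : Measure B) with hm
  have hmb : -b ≤ m := by
    have := norm_integral_le_of_norm_le_const (μ := (μ : Measure B)) (C := b)
      (f := fun x : B => Φ x) (ae_of_all _ fun x => hb x)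
    rw [probReal_univ, mul_one] at this
    exact (abs_le.1 this).1
  let A : ℕ → B → ℝ := fun n x =>
    1 / ((n : ℝ) + 1) * ∫ t in (0 : ℝ)..((n : ℝ) + 1), Φ (φ t.toNNReal x)
  have hn : ∀ n : ℕ, (0 : ℝ) < n + 1 := fun n => by positivity
  have hAb : ∀ n x, |A n x| ≤ b := by
    intro n x
    have := intervalIntegral.norm_integral_le_of_norm_le_const (a := 0) (b := (n : ℝ) + 1) (C := b)
      (f := fun t : ℝ => Φ (φ t.toNNReal x)) (fun t _ => hb _)
    rw [sub_zero, abs_of_pos (hn n)] at this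
    rw [abs_mul, abs_of_pos (one_div_pos.2 (hn n)), one_div, inv_mul_le_iff₀ (hn n), mul_comm]
    exact this
  have hAc : ∀ n, Continuous (A n) := by
    intro n
    refine continuous_const.mul
      (intervalIntegral.continuous_parametric_intervalIntegral_of_continuous' ?_ _ _)
    exact hΦB.comp ((hφ.continuous hf hBc).comp
      ((continuous_real_toNNReal.comp continuous_snd).prodMk continuous_fst))
  have hAint : ∀ n, ∫ x, A n x ∂(μ : Measure B) = m := by
    intro n
    rw [integral_const_mul, ← hφ.integral_integral_swap hf hBc hΦB]
    simp only [hμ.integral_comp hφ hf hBc hΦB]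
    rw [← hm, intervalIntegral.integral_const, sub_zero, smul_eq_mul, one_div,
      inv_mul_cancel_left₀ (hn n).ne']
  -- Adding `b` makes the averages nonnegative; the extra `1` makes `m + (b + 1)` positive, so that
  -- the truncation in `ENNReal.ofReal` loses nothing in the final comparison.
  have hlint : ∀ n, ∫⁻ x, ENNReal.ofReal (A n x + (b + 1)) ∂(μ : Measure B)
      = ENNReal.ofReal (m + (b + 1)) := by
    intro n
    have hi := (hAc n).integrable_of_isCompact hBc (μ : Measure B)
    have hi' : Integrable (fun x => A n x + (b + 1)) (μ : Measure B) :=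
      hi.add (integrable_const _)
    rw [← ofReal_integral_eq_lintegral_ofReal hi' (ae_of_all _ fun x => by
      have := (abs_le.1 (hAb n x)).1
      simp only [Pi.zero_apply]
      linarith)]
    rw [integral_add hi (integrable_const _), hAint]
    simp
  -- Reverse Fatou, with a constant dominating function. Integer times suffice, since the limsup
  -- along them is at most the limsup over real `T`.
  have hfatou := limsup_lintegral_le (μ := (μ : Measure B))
    (f := fun n x => ENNReal.ofReal (A n x + (b + 1))) (fun _ => ENNReal.ofReal (b + (b + 1)))
    (fun n => ((hAc n).add continuous_const).measurable.ennreal_ofReal)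
    (fun n => ae_of_all _ fun x => ENNReal.ofReal_le_ofReal (by linarith [(abs_le.1 (hAb n x)).2]))
    (by simp)
  simp only [hlint, limsup_const] at hfatou
  obtain ⟨x, hx⟩ := exists_lintegral_le (μ := (μ : Measure B))
    (f := fun x => limsup (fun n => ENNReal.ofReal (A n x + (b + 1))) atTop) (by
      refine ne_top_of_le_ne_top (ENNReal.ofReal_ne_top (r := b + (b + 1))) ?_
      refine (lintegral_mono (g := fun _ => ENNReal.ofReal (b + (b + 1))) fun x => ?_).trans
        (by simp)
      exact limsup_le_of_le (by isBoundedDefault) (Eventually.of_forall fun n =>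
        ENNReal.ofReal_le_ofReal (by linarith [(abs_le.1 (hAb n x)).2])))
  refine ⟨x, ?_⟩
  by_contra hlt
  rw [not_le] at hlt
  obtain ⟨r, hr1, hr2⟩ := EReal.lt_iff_exists_real_btwn.1 hlt
  rw [EReal.coe_lt_coe_iff] at hr2
  have hev := eventually_lt_of_limsup_lt hr1
  have hevn := (tendsto_atTop_add_const_right _ (1 : ℝ)
    (tendsto_natCast_atTop_atTop (R := ℝ))).eventually hev
  have hle : limsup (fun n => ENNReal.ofReal (A n x + (b + 1))) atTop
      ≤ ENNReal.ofReal (r + (b + 1)) := by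
    refine limsup_le_of_le (by isBoundedDefault) ?_
    filter_upwards [hevn] with n hn
    rw [EReal.coe_lt_coe_iff] at hn
    exact ENNReal.ofReal_le_ofReal (by simp only [A]; linarith)
  have := (hfatou.trans hx).trans hle
  rw [ENNReal.ofReal_le_ofReal_iff'] at this
  rcases this with h | h <;> linarith

end LongTimeAverages

/-! ### Ergodic optimal measures as extreme points -/

section ErgodicMeasures

variable {d : ℕ} {f : PhaseSpace d → PhaseSpace d} {B : Set (PhaseSpace d)} {φ : ℝ≥0 → B → B}

/-- Conditioning an invariant measure on an invariant set gives an invariant measure. -/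
theorem IsInvariantMeasure.cond {μ ν : ProbabilityMeasure B} (hμ : IsInvariantMeasure φ μ)
    {A : Set B} (hA : MeasurableSet A) (hφA : ∀ t, φ t ⁻¹' A = A)
    (hν : (ν : Measure B) = ProbabilityTheory.cond (μ : Measure B) A) :
    IsInvariantMeasure φ ν := by
  intro t S hS
  rw [hν, ProbabilityTheory.cond_apply hA, ProbabilityTheory.cond_apply hA]
  nth_rewrite 2 [← hφA t]
  rw [← preimage_inter, hμ t _ (hA.inter hS)]

theorem integral_eq_measureReal_mul_integral_cond {X : Type*} [MeasurableSpace X] {μ : Measure X}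
    [IsFiniteMeasure μ] {A : Set X} (hA : MeasurableSet A) (h0 : μ A ≠ 0) (h0' : μ Aᶜ ≠ 0)
    {h : X → ℝ} (hh : Integrable h μ) :
    ∫ x, h x ∂μ = μ.real A * ∫ x, h x ∂(ProbabilityTheory.cond μ A)
      + μ.real Aᶜ * ∫ x, h x ∂(ProbabilityTheory.cond μ Aᶜ) := by
  have key : ∀ S : Set X, μ S ≠ 0 →
      μ.real S * ∫ x, h x ∂(ProbabilityTheory.cond μ S) = ∫ x in S, h x ∂μ := by
    intro S hS
    have : μ.real S ≠ 0 := (ENNReal.toReal_pos hS (measure_ne_top μ S)).ne'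
    rw [ProbabilityTheory.cond, integral_smul_measure, ENNReal.toReal_inv, smul_eq_mul]
    exact mul_inv_cancel_left₀ this _
  rw [key A h0, key _ h0', integral_add_compl hA hh]

/-- If `M` is the maximum of the means of a continuous function with respect to invariant measures,
then it is attained at an ergodic measure. -/
theorem IsFlowOn.exists_isErgodicMeasure (hφ : IsFlowOn f B φ) (hf : ContDiff ℝ 1 f)
    (hBc : IsCompact B) {h : B → ℝ} (hh : Continuous h) {M : ℝ}
    (hM : ∀ μ : ProbabilityMeasure B, IsInvariantMeasure φ μ → ∫ x, h x ∂(μ : Measure B) ≤ M)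
    (hattained : ∃ μ : ProbabilityMeasure B, IsInvariantMeasure φ μ ∧
      ∫ x, h x ∂(μ : Measure B) = M) :
    ∃ μ : ProbabilityMeasure B, IsErgodicMeasure φ μ ∧ ∫ x, h x ∂(μ : Measure B) = M := by
  have : CompactSpace B := isCompact_iff_compactSpace.1 hBc
  have hcont : ∀ k : B → ℝ, Continuous k →
      Continuous fun μ : ProbabilityMeasure B => ∫ x, k x ∂(μ : Measure B) := fun k hk =>
    ProbabilityMeasure.continuous_integral_boundedContinuousFunction
      (BoundedContinuousFunction.mkOfCompact ⟨k, hk⟩)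
  -- The embedding into `ℝ^C(B)` places the measures in a locally convex space, where compact
  -- nonempty sets have extreme points.
  let I : ProbabilityMeasure B → (C(B, ℝ) → ℝ) := fun μ k => ∫ x, k x ∂(μ : Measure B)
  have hI : Continuous I := continuous_pi fun k => hcont k k.continuous
  have hinj : Function.Injective I := by
    intro μ ν hμν
    have h : (μ : Measure B) = ν := Measure.ext_of_integral_auxFunctions hBc fun V hV =>
      congrFun hμν ⟨fun x : B => V x, continuous_restrict_of_mem_auxFunctions hV⟩
    exact Subtype.ext h
  let S : Set (ProbabilityMeasure B) :=
    {μ | IsInvariantMeasure φ μ ∧ ∫ x, h x ∂(μ : Measure B) = M}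
  have hS : IsClosed S := by
    refine (?_ : IsClosed {μ : ProbabilityMeasure B | IsInvariantMeasure φ μ}).inter
      (isClosed_eq (hcont h hh) continuous_const)
    -- Zero divergence consists of equations between integrals of continuous functions, so it is
    -- visibly closed under weak convergence.
    simp only [isInvariantMeasure_iff_isWeaklyDivFree hφ hf hBc, IsWeaklyDivFree, ofPred_forall]
    refine isClosed_iInter fun ψ => isClosed_iInter fun hψ => isClosed_iInter fun _ => ?_
    exact isClosed_eq (hcont _ (continuous_restrict_orbitalDeriv hf
      (hψ.of_le (by simp)).mem_auxFunctions)) continuous_const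
  obtain ⟨_, hext⟩ :=
    (hS.isCompact.image hI).extremePoints_nonempty (Set.Nonempty.image I hattained)
  rw [mem_extremePoints_iff_left] at hext
  obtain ⟨⟨μ, hμ, rfl⟩, hext⟩ := hext
  refine ⟨μ, ⟨hμ.1, fun A hA hφA => ?_⟩, hμ.2⟩
  by_contra! hA01
  have h0 : (μ : Measure B) A ≠ 0 := hA01.1
  have h0' : (μ : Measure B) Aᶜ ≠ 0 := fun h => hA01.2 ((prob_compl_eq_zero_iff hA).1 h)
  have hφA' : ∀ t, φ t ⁻¹' Aᶜ = Aᶜ := fun t => by rw [preimage_compl, hφA]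
  let ν : ProbabilityMeasure B := ⟨_, ProbabilityTheory.cond_isProbabilityMeasure h0⟩
  let ν' : ProbabilityMeasure B := ⟨_, ProbabilityTheory.cond_isProbabilityMeasure h0'⟩
  have hν : IsInvariantMeasure φ ν := hμ.1.cond hA hφA rfl
  have hν' : IsInvariantMeasure φ ν' := hμ.1.cond hA.compl hφA' rfl
  have ha : 0 < (μ : Measure B).real A := ENNReal.toReal_pos h0 (measure_ne_top _ _)
  have ha' : 0 < (μ : Measure B).real Aᶜ := ENNReal.toReal_pos h0' (measure_ne_top _ _)
  have hsum : (μ : Measure B).real A + (μ : Measure B).real Aᶜ = 1 := by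
    rw [measureReal_add_measureReal_compl hA, probReal_univ]
  have hsplit : ∀ k : B → ℝ, Continuous k → ∫ x, k x ∂(μ : Measure B)
      = (μ : Measure B).real A * ∫ x, k x ∂(ν : Measure B)
        + (μ : Measure B).real Aᶜ * ∫ x, k x ∂(ν' : Measure B) := fun k hk =>
    integral_eq_measureReal_mul_integral_cond hA h0 h0' (hk.integrable_of_isCompact hBc _)
  have hMsplit := hsplit h hh
  rw [hμ.2] at hMsplit
  have hMsum : (μ : Measure B).real A * M + (μ : Measure B).real Aᶜ * M = M := by
    rw [← add_mul, hsum, one_mul]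
  -- Two numbers at most `M` whose average with positive weights is `M` both equal `M`, so both
  -- conditional measures are optimal and extremality applies.
  have hνM : ∫ x, h x ∂(ν : Measure B) = M := by
    refine le_antisymm (hM ν hν) (le_of_mul_le_mul_left ?_ ha)
    linarith [mul_le_mul_of_nonneg_left (hM ν' hν') ha'.le]
  have hνM' : ∫ x, h x ∂(ν' : Measure B) = M := by
    refine le_antisymm (hM ν' hν') (le_of_mul_le_mul_left ?_ ha')
    linarith [mul_le_mul_of_nonneg_left (hM ν hν) ha.le]
  have hνμ : ν = μ := hinj (hext _ ⟨ν, ⟨hν, hνM⟩, rfl⟩ _ ⟨ν', ⟨hν', hνM'⟩, rfl⟩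
    ⟨_, _, ha, ha', hsum, funext fun k => (hsplit k k.continuous).symm⟩)
  have hνA : (ν : Measure B) A = 1 := ProbabilityTheory.cond_apply_self h0 (measure_ne_top _ _)
  rw [hνμ] at hνA
  exact hA01.2 hνA

end ErgodicMeasures

/-! ### The Lagrangian and its infimum over auxiliary functions -/

section Optimization

variable {d : ℕ} {f : PhaseSpace d → PhaseSpace d} {B : Set (PhaseSpace d)} {φ : ℝ≥0 → B → B}
  {Φ : PhaseSpace d → ℝ}

theorem lagrangian_eq_add (hf : ContDiff ℝ 1 f) (hΦ : Continuous Φ) (hBc : IsCompact B)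
    (μ : ProbabilityMeasure B) {V : PhaseSpace d → ℝ} (hV : V ∈ auxFunctions B) :
    lagrangian f Φ μ V
      = ∫ x : B, Φ x ∂(μ : Measure B) + ∫ x : B, orbitalDeriv f V x ∂(μ : Measure B) :=
  integral_add (integrable_of_continuousOn hBc hΦ.continuousOn μ)
    (integrable_of_continuousOn hBc (continuousOn_orbitalDeriv hf.continuous hV) μ)

/-- If `μ` is not weakly divergence-free, the integrals of orbital derivatives of auxiliary
functions take all real values. -/
theorem exists_integral_orbitalDeriv_eq {μ : ProbabilityMeasure B} (hμ : ¬ IsWeaklyDivFree f μ)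
    (c : ℝ) : ∃ V ∈ auxFunctions B, ∫ x : B, orbitalDeriv f V x ∂(μ : Measure B) = c := by
  simp only [IsWeaklyDivFree, not_forall] at hμ
  obtain ⟨ψ, hψ, -, hne⟩ := hμ
  have hψ' : ψ ∈ auxFunctions B := (hψ.of_le (by simp)).mem_auxFunctions
  refine ⟨_, const_mul_mem_auxFunctions hψ'
    (c / ∫ x : B, orbitalDeriv f ψ x ∂(μ : Measure B)), ?_⟩
  have h : ∀ (a : ℝ) (x : B), orbitalDeriv f (fun y => a * ψ y) x = a * orbitalDeriv f ψ x :=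
    fun a x => orbitalDeriv_const_mul hψ' a x.2
  simp only [h]
  rw [integral_const_mul, div_mul_cancel₀ _ hne]

theorem zero_mem_auxFunctions : (fun _ => 0) ∈ auxFunctions B :=
  contDiff_const.mem_auxFunctions

theorem iInf_integral_orbitalDeriv_eq_zero (hφ : IsFlowOn f B φ) (hf : ContDiff ℝ 1 f)
    (hBc : IsCompact B) {μ : ProbabilityMeasure B} (hμ : IsWeaklyDivFree f μ) :
    (⨅ V ∈ auxFunctions B,
      ((∫ x : B, orbitalDeriv f V x ∂(μ : Measure B) : ℝ) : EReal)) = 0 := by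
  refine le_antisymm ((iInf₂_le _ zero_mem_auxFunctions).trans ?_) (le_iInf₂ fun V hV => ?_)
  · rw [hμ.integral_orbitalDeriv hφ hf hBc zero_mem_auxFunctions, EReal.coe_zero]
  · rw [hμ.integral_orbitalDeriv hφ hf hBc hV, EReal.coe_zero]

theorem iInf_integral_orbitalDeriv_eq_bot {μ : ProbabilityMeasure B}
    (hμ : ¬ IsWeaklyDivFree f μ) :
    (⨅ V ∈ auxFunctions B,
      ((∫ x : B, orbitalDeriv f V x ∂(μ : Measure B) : ℝ) : EReal)) = ⊥ := by
  rw [EReal.eq_bot_iff_forall_lt]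
  intro y
  obtain ⟨V, hV, h⟩ := exists_integral_orbitalDeriv_eq hμ (y - 1)
  refine (iInf₂_le V hV).trans_lt ?_
  rw [h, EReal.coe_lt_coe_iff]
  linarith

end Optimization

/-! ### The equality of all the optimal values -/

theorem mainTheorem1 (d : ℕ) (f : PhaseSpace d → PhaseSpace d) (hf : ContDiff ℝ 1 f)
    (Φ : PhaseSpace d → ℝ) (hΦ : Continuous Φ)
    (B : Set (PhaseSpace d)) (hBc : IsCompact B) (hBne : B.Nonempty)
    (hB : TrapsTrajectories f B) :
    -- the forward flow on `B` exists and is unique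
    (∃! φ : ℝ≥0 → B → B, IsFlowOn f B φ) ∧
    ∀ φ : ℝ≥0 → B → B, IsFlowOn f B φ →
      -- `div (f μ) = 0` is equivalent to invariance
      (∀ μ : ProbabilityMeasure B, IsInvariantMeasure φ μ ↔ IsWeaklyDivFree f μ) ∧
      -- auxiliary functions are Lagrange multipliers for invariance
      (∀ μ : ProbabilityMeasure B,
        (IsWeaklyDivFree f μ →
          (⨅ V ∈ auxFunctions B,
            ((∫ x : B, orbitalDeriv f V x ∂(μ : Measure B) : ℝ) : EReal)) = 0) ∧
        (¬ IsWeaklyDivFree f μ →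
          (⨅ V ∈ auxFunctions B,
            ((∫ x : B, orbitalDeriv f V x ∂(μ : Measure B) : ℝ) : EReal)) = ⊥)) ∧
      -- for each auxiliary function the maximum of `Φ + f · ∇V` over `B` is attained
      (∀ V ∈ auxFunctions B, ∃ x ∈ B, IsMaxOn (fun y => Φ y + orbitalDeriv f V y) B x) ∧
      -- the common optimal value `M`
      ∃ M : ℝ,
        IsGreatest (range fun x₀ : B => longTimeAverage Φ (fun t => (φ t x₀ : PhaseSpace d)))
          (M : EReal) ∧
        IsGreatest {r : ℝ | ∃ μ : ProbabilityMeasure B, IsInvariantMeasure φ μ ∧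
          ∫ x : B, Φ x ∂(μ : Measure B) = r} M ∧
        (∃ μ : ProbabilityMeasure B, IsErgodicMeasure φ μ ∧
          ∫ x : B, Φ x ∂(μ : Measure B) = M) ∧
        (⨆ μ : ProbabilityMeasure B, ⨅ V ∈ auxFunctions B, (lagrangian f Φ μ V : EReal)) = M ∧
        (⨅ V ∈ auxFunctions B, ⨆ μ : ProbabilityMeasure B, (lagrangian f Φ μ V : EReal)) = M ∧
        (⨅ V ∈ auxFunctions B, ⨆ x : B, ((Φ x + orbitalDeriv f V x : ℝ) : EReal)) = M := by
  have hΦB : Continuous fun x : B => Φ x := hΦ.comp continuous_subtype_val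
  refine ⟨existsUnique_isFlowOn hf hBc hB, fun φ hφ => ⟨isInvariantMeasure_iff_isWeaklyDivFree hφ hf
    hBc, fun μ => ⟨iInf_integral_orbitalDeriv_eq_zero hφ hf hBc,
      iInf_integral_orbitalDeriv_eq_bot⟩, fun V hV => hBc.exists_isMaxOn hBne
        (hΦ.continuousOn.add (continuousOn_orbitalDeriv hf.continuous hV)), ?_⟩⟩
  -- This single `μ` is optimal throughout: its mean `M` is approached from above by the bounds in
  -- `hdual`, and every value in the chain is compared with `M`.
  obtain ⟨μ, hμ, hdual⟩ := hφ.exists_isInvariantMeasure_forall_lt hf hBc hBne hΦB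
  set M : ℝ := ∫ x : B, Φ x ∂(μ : Measure B) with hM
  have hlag : ∀ ν : ProbabilityMeasure B, IsInvariantMeasure φ ν → ∀ V ∈ auxFunctions B,
      lagrangian f Φ ν V = ∫ x : B, Φ x ∂(ν : Measure B) := fun ν hν V hV => by
    rw [lagrangian_eq_add hf hΦ hBc ν hV, hν.integral_orbitalDeriv hφ hf hBc hV, add_zero]
  have hint : ∀ (ν : ProbabilityMeasure B), ∀ V ∈ auxFunctions B,
      Integrable (fun x : B => Φ x + orbitalDeriv f V x) (ν : Measure B) := fun ν V hV =>
    (hΦB.add (continuous_restrict_orbitalDeriv hf hV)).integrable_of_isCompact hBc _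
  have hlag_le : ∀ (ν : ProbabilityMeasure B), ∀ V ∈ auxFunctions B, ∀ r : ℝ,
      (∀ x : B, Φ x + orbitalDeriv f V x ≤ r) → lagrangian f Φ ν V ≤ r := fun ν V hV r hr => by
    simpa [lagrangian] using integral_mono (hint ν V hV) (integrable_const r) hr
  have hmax : ∀ ν : ProbabilityMeasure B, IsInvariantMeasure φ ν →
      ∫ x : B, Φ x ∂(ν : Measure B) ≤ M := fun ν hν => by
    refine le_of_forall_gt_imp_ge_of_dense fun r hr => ?_
    obtain ⟨V, hV, hle⟩ := hdual r hr
    rw [← hlag ν hν V hV]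
    exact hlag_le ν V hV r hle
  have havg : ∀ x : B, longTimeAverage Φ (fun t => (φ t x : PhaseSpace d)) ≤ M := fun x => by
    refine EReal.le_of_forall_lt_iff_le.1 fun r hr => ?_
    obtain ⟨V, hV, hle⟩ := hdual r (EReal.coe_lt_coe_iff.1 hr)
    exact hφ.longTimeAverage_le hf hBc hΦ hV hle x
  obtain ⟨x, hx⟩ := hμ.exists_le_longTimeAverage hφ hf hBc hΦ
  refine ⟨M, ⟨⟨x, (havg x).antisymm hx⟩, ?_⟩, ⟨⟨μ, hμ, rfl⟩, ?_⟩,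
    hφ.exists_isErgodicMeasure hf hBc hΦB hmax ⟨μ, hμ, rfl⟩, ?_, ?_, ?_⟩
  · rintro _ ⟨x, rfl⟩
    exact havg x
  · rintro _ ⟨ν, hν, rfl⟩
    exact hmax ν hν
  · refine le_antisymm (iSup_le fun ν => ?_)
      (le_iSup_of_le μ (le_iInf₂ fun V hV => (congrArg _ (hlag μ hμ V hV)).ge))
    by_cases hν : IsWeaklyDivFree f ν
    · have hν' := (isInvariantMeasure_iff_isWeaklyDivFree hφ hf hBc ν).2 hν
      refine (iInf₂_le _ zero_mem_auxFunctions).trans ?_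
      rw [hlag ν hν' _ zero_mem_auxFunctions]
      exact EReal.coe_le_coe_iff.2 (hmax ν hν')
    -- The infimum is `⊥` here, but `≤ M` suffices: `V` is chosen so that the Lagrangian equals `M`.
    · obtain ⟨V, hV, h⟩ := exists_integral_orbitalDeriv_eq hν
        (M - ∫ x : B, Φ x ∂(ν : Measure B))
      refine (iInf₂_le V hV).trans ?_
      rw [lagrangian_eq_add hf hΦ hBc ν hV, h, add_sub_cancel]
  · refine le_antisymm (EReal.le_of_forall_lt_iff_le.1 fun r hr => ?_)
      (le_iInf₂ fun V hV => le_iSup_of_le μ (congrArg _ (hlag μ hμ V hV)).ge)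
    obtain ⟨V, hV, hle⟩ := hdual r (EReal.coe_lt_coe_iff.1 hr)
    exact (iInf₂_le V hV).trans
      (iSup_le fun ν => EReal.coe_le_coe_iff.2 (hlag_le ν V hV r hle))
  · refine le_antisymm (EReal.le_of_forall_lt_iff_le.1 fun r hr => ?_) (le_iInf₂ fun V hV => ?_)
    · obtain ⟨V, hV, hle⟩ := hdual r (EReal.coe_lt_coe_iff.1 hr)
      exact (iInf₂_le V hV).trans (iSup_le fun x => EReal.coe_le_coe_iff.2 (hle x))
    · obtain ⟨x, hx⟩ := exists_integral_le (hint μ V hV)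
      refine le_iSup_of_le x (EReal.coe_le_coe_iff.2 ?_)
      rw [hM, ← hlag μ hμ V hV]
      exact hx
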